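/- **Theorem (Huxley and Sargos, explicit form).** Let $k\ge 3$ be an integer and $c_k\ge 1$ a real number. Let $N\ge 1$ be an integer, $f\in C^k[N,2N]$ a real function and $\lambda_k>0$ such that $\lambda_k\le |f^{(k)}(x)|\le c_k\lambda_k$ for all $x\in[N,2N]$, and let $0<\delta<\tfrac14$. Write $\|x\|$ for the distance from $x$ to the nearest integer and $\lfloor x\rceil$ for the nearest integer, let $\mathcal S=\{n\in[N,2N]\cap\mathbb Z:\ \|f(n)\|<\delta\}$, and let $\mathcal R(f,N,\delta)=|\mathcal S|$. *Definitions.* A major arc is a set $\mathcal A$ of at least $k+1$ consecutive elements of $\mathcal S$ such that for some polynomial $P\in\mathbb Q[X]$ of degree $<k$ one has $P(n)=\lfloor f(n)\rceil$ for all $n\in\mathcal A$, and which is maximal (for inclusion) with these properties; $P$ is then unique. The denominator of $\mathcal A$ is the least positive integer $q$ with $P\in\frac1q\mathbb Z[X]$. Among the connected components of $\{(x,y): x\in[N,2N],\ |y-f(x)|<\delta,\ y=P(x)\}$ choose one containing the largest number of the points $(n,\lfloor f(n)\rceil)$, $n\in\mathcal A$; if this number is larger than $k$, the set $\bar{\mathcal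 A}$ of the corresponding $n$ is called the proper major arc extracted from $\mathcal A$, its denominator is that of $\mathcal A$, and its length $L$ is its largest element minus its smallest element. (If there are several such components, one of them is chosen.) Put $$a_k=36e^{-2}k(2e^3)^kc_k,\qquad \alpha_k=2k^2c_k^{\frac{2}{k(k+1)}},\qquad \beta_k=4k^2\Big(5e^3c_k^{\frac{2}{k(k-1)}}+1\Big),\qquad \beta_k'=30e^3k^2c_k^{\frac{2}{k(k-1)}}+4k^2 .$$ 1. Suppose that the choices can be made so that the proper major arcs with denominator $\le (a_k\delta)^{-1}$ can be covered by pairwise disjoint intervals, one interval for each of them, the interval belonging to a proper major arc of length $L_j$ and denominator $q_j$ having length exactly $L_j(a_kq_j\delta)^{-1/k}$. Then $$\mathcal R(f,N,\delta)\le \alpha_kN\lambda_k^{\frac{2}{k(k+1)}}+\beta_kN\delta^{\frac{2}{k(k-1)}}+8k^3\Big(\frac{\delta}{\lambda_k}\Big)^{\frac1k}+2k^2(5e^3+1).$$ 2. Without that assumption, $$\mathcal R(f,N,\delta)\le \alpha_kN\lambda_k^{\frac{2}{k(k+1)}}+\beta_k'N\delta^{\frac{2}{k(k-1)}}+16k^3\Big(\frac{\delta}{\lambda_k}\Big)^{\frac1k}+2k^2(5e^3+1).$$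 3. Consequently there is a constant $C>0$, depending only on $k$ and $c_k$, such that in all cases $$\mathcal R(f,N,\delta)\le C\Big(N\lambda_k^{\frac{2}{k(k+1)}}+N\delta^{\frac{2}{k(k-1)}}+\Big(\frac{\delta}{\lambda_k}\Big)^{\frac1k}+1\Big).$$ -/

import Mathlib

noncomputable section

namespace HuxleySargos

/-- `‖x‖`: the distance from `x` to a nearest integer. -/
def distInt (x : ℝ) : ℝ := |x - (round x : ℝ)|

open Classical in
/-- `S(f, N, δ)`: the integers `n` in `[N, 2N]` with `‖f(n)‖ < δ`. -/
def closePoints (f : ℝ → ℝ) (N : ℕ) (δ : ℝ) : Finset ℤ :=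
  (Finset.Icc (N : ℤ) (2 * (N : ℤ))).filter fun n => distInt (f (n : ℝ)) < δ

/-- `R(f, N, δ)`: the number of elements of `S(f, N, δ)`. -/
def closeCount (f : ℝ → ℝ) (N : ℕ) (δ : ℝ) : ℕ := (closePoints f N δ).card

/-- `A` is a set of at least `k + 1` consecutive points of `S(f, N, δ)`, and `P` is a polynomial
of degree `< k` that interpolates the points `(n, ⌊f(n)⌉)`, `n ∈ A`
(there is at most one such `P`, because `A` has more than `k` elements). -/
structure IsArc (k : ℕ) (f : ℝ → ℝ) (N : ℕ) (δ : ℝ) (P : Polynomial ℚ) (A : Finset ℤ) :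
    Prop where
  subset : A ⊆ closePoints f N δ
  consecutive : ∀ a ∈ A, ∀ b ∈ A, ∀ n ∈ closePoints f N δ, a ≤ n → n ≤ b → n ∈ A
  card_ge : k + 1 ≤ A.card
  degree_lt : P.degree < (k : WithBot ℕ)
  interpolates : ∀ n ∈ A, P.eval (n : ℚ) = (round (f (n : ℝ)) : ℚ)

/-- `A` is a major arc with equation `y = P(x)`: it is maximal for inclusion. -/
def IsMajorArc (k : ℕ) (f : ℝ → ℝ) (N : ℕ) (δ : ℝ) (P : Polynomial ℚ) (A : Finset ℤ) : Prop :=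
  Maximal (IsArc k f N δ P) A

/-- The least positive integer `q` with `P ∈ (1/q) ℤ[X]`. -/
def denominator (P : Polynomial ℚ) : ℕ :=
  sInf {q : ℕ | 0 < q ∧ ∀ i : ℕ, ∃ z : ℤ, (q : ℚ) * P.coeff i = (z : ℚ)}

/-- The plane region `C_δ = {(x, y) : x ∈ [N, 2N], |y - f(x)| < δ}`. -/
def tube (f : ℝ → ℝ) (N : ℕ) (δ : ℝ) : Set (ℝ × ℝ) :=
  {p | p.1 ∈ Set.Icc (N : ℝ) (2 * (N : ℝ)) ∧ |p.2 - f p.1| < δ}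

/-- The plane curve `C_P` with equation `y = P(x)`. -/
def curve (P : Polynomial ℚ) : Set (ℝ × ℝ) := {p | p.2 = Polynomial.aeval p.1 P}

open Classical in
/-- The elements `n` of `A` whose point `(n, ⌊f(n)⌉)` lies on the connected component of
`C_δ ∩ C_P` that contains `z`. -/
def componentPoints (f : ℝ → ℝ) (N : ℕ) (δ : ℝ) (P : Polynomial ℚ) (A : Finset ℤ)
    (z : ℝ × ℝ) : Finset ℤ :=
  A.filter fun n =>
    ((n : ℝ), (round (f (n : ℝ)) : ℝ)) ∈ connectedComponentIn (tube f N δ ∩ curve P) z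

/-- `B` is a proper major arc extracted from the major arc `A` with equation `y = P(x)`: the
elements of `A` on a connected component of `C_δ ∩ C_P` that carries the largest number of them,
this number being larger than `k`. -/
def IsProperMajorArc (k : ℕ) (f : ℝ → ℝ) (N : ℕ) (δ : ℝ) (P : Polynomial ℚ)
    (A B : Finset ℤ) : Prop :=
  IsMajorArc k f N δ P A ∧ k < B.card ∧
    ∃ z ∈ tube f N δ ∩ curve P, B = componentPoints f N δ P A z ∧
      ∀ w ∈ tube f N δ ∩ curve P, (componentPoints f N δ P A w).card ≤ B.card

/-- The length of a finite set of integers: its last point minus its first point. -/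
def arcLength (B : Finset ℤ) : ℝ :=
  if h : B.Nonempty then ((B.max' h - B.min' h : ℤ) : ℝ) else 0

/-- The number `a_k = 36 e⁻² k (2 e³)^k c_k`. -/
def aConst (k : ℕ) (c : ℝ) : ℝ :=
  36 * Real.exp (-2) * (k : ℝ) * (2 * Real.exp 3) ^ k * c

/-- `I` is an interval (open, closed or half-open) of length `d`. -/
def IsIntervalOfLength (I : Set ℝ) (d : ℝ) : Prop :=
  ∃ u : ℝ, Set.Ioo u (u + d) ⊆ I ∧ I ⊆ Set.Icc u (u + d)

/-- One can extract from each major arc `A` that has proper major arcs one of these, `bar A`, and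
cover those `bar A` whose denominator `q` satisfies `q ≤ (a_k δ)⁻¹` by pairwise disjoint intervals
`I A`, of length `L (a_k q δ)^(-1/k)`, where `L` is the length of `bar A`. -/
def HasDisjointCovers (k : ℕ) (c : ℝ) (f : ℝ → ℝ) (N : ℕ) (δ : ℝ) : Prop :=
  ∃ (bar : Finset ℤ → Finset ℤ) (I : Finset ℤ → Set ℝ),
    (∀ P A B, IsProperMajorArc k f N δ P A B → IsProperMajorArc k f N δ P A (bar A)) ∧
    (∀ P A, IsProperMajorArc k f N δ P A (bar A) →
      (denominator P : ℝ) ≤ (aConst k c * δ)⁻¹ →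
        IsIntervalOfLength (I A)
          (arcLength (bar A) * (aConst k c * (denominator P : ℝ) * δ) ^ (-(1 / (k : ℝ)))) ∧
        ∀ n ∈ bar A, (n : ℝ) ∈ I A) ∧
    (∀ P A P' A', IsProperMajorArc k f N δ P A (bar A) →
      (denominator P : ℝ) ≤ (aConst k c * δ)⁻¹ →
      IsProperMajorArc k f N δ P' A' (bar A') →
      (denominator P' : ℝ) ≤ (aConst k c * δ)⁻¹ →
      A ≠ A' → Disjoint (I A) (I A'))

/-- The setting: `f ∈ C^k[N, 2N]`, `0 < λ`, `λ ≤ |f^{(k)}| ≤ c λ` on `[N, 2N]`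
(one-sided derivatives at the end points), and `0 < δ < 1/4`. -/
structure Setting (k : ℕ) (c : ℝ) (f : ℝ → ℝ) (N : ℕ) (lam δ : ℝ) : Prop where
  one_le_N : 1 ≤ N
  contDiffOn : ContDiffOn ℝ (k : WithTop ℕ∞) f (Set.Icc (N : ℝ) (2 * (N : ℝ)))
  lam_pos : 0 < lam
  bounds : ∀ x ∈ Set.Icc (N : ℝ) (2 * (N : ℝ)),
    lam ≤ |iteratedDerivWithin k f (Set.Icc (N : ℝ) (2 * (N : ℝ))) x| ∧
    |iteratedDerivWithin k f (Set.Icc (N : ℝ) (2 * (N : ℝ))) x| ≤ c * lam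
  delta_pos : 0 < δ
  delta_lt : δ < 1 / 4

end HuxleySargos

end

namespace HuxleySargos

open Set Polynomial

/-! Write m(n) for the integer nearest to f(n). A polynomial P of degree < k through k of the points
(n, m(n)) takes rational values with controlled denominator at the integers, so at an integer s with
P(s) ≠ m(s) the gap |P(s) - m(s)| cannot be tiny. Lagrange interpolation with remainder bounds the
same gap from above in terms of δ and f^(k). Together these force s to be far from the earlier
points.

The set S is cut greedily. Let w be the first remaining point, P the polynomial through the first k
remaining points, s the first remaining point off its curve, and D a distance from s back to an
earlier point. If fewer than 2k² points precede s, the product of differences is a denominator, and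
`one_le_of_eval_ne` with `one_le_rpow_add_mul` bounds s - w below. If at least 2k² points precede s,
`exists_interval_of_arc` gives an interval of length L on which |f - P| < δ, and bounds the number
of points by 2k² L q^(-e), where q is a common denominator of the values of P at the integers and e
= 2/(k(k-1)). By `abs_sub_eval_le_of_small`, f - P grows at most like δ(D/L)^k beyond the interval.
Since the gap at s is at least 1/q, (L/D)^k ≤ Cqδ; as L ≤ D and ke ≤ 1, this gives L/D ≤ (Cqδ)^e,
and the powers of q cancel. In both cases the number of points removed is at most a constant times s
- w, and these costs telescope to a multiple of N (`card_le_of_initial_segments`). A final piece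
without such an s is either short or a single arc, whose length is O((δ/λ)^(1/k)) because |f^(k)| ≥
λ (`card_last_arc_le`). All stated bounds follow from this estimate by comparing constants. -/

/-! ### Rolle's theorem and Lagrange interpolation with remainder -/

/-- Generalized Rolle theorem: a function with `m + 1` zeros has a zero of its `m`-th derivative. -/
theorem exists_iteratedDerivWithin_eq_zero {a b : ℝ} (hab : a < b) (m : ℕ) (h : ℝ → ℝ)
    (hh : ContDiffOn ℝ m h (Icc a b)) (Z : Finset ℝ) (hZ : ∀ z ∈ Z, z ∈ Icc a b ∧ h z = 0)
    (hcard : m + 1 ≤ Z.card) :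
    ∃ ξ ∈ Icc a b, iteratedDerivWithin m h (Icc a b) ξ = 0 := by
  induction m generalizing h Z with
  | zero =>
    obtain ⟨z, hz⟩ : Z.Nonempty := Finset.card_pos.1 (by omega)
    exact ⟨z, (hZ z hz).1, by simpa using (hZ z hz).2⟩
  | succ m ih =>
    obtain ⟨Z', hZ', hc'⟩ := Finset.exists_subset_card_eq hcard
    let z := Z'.orderEmbOfFin hc'
    have hz : ∀ i, z i ∈ Icc a b ∧ h (z i) = 0 := fun i =>
      hZ _ (hZ' (Finset.orderEmbOfFin_mem Z' hc' i))
    have key : ∀ i : Fin (m + 1), ∃ y ∈ Ioo (z i.castSucc) (z i.succ),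
        derivWithin h (Icc a b) y = 0 := by
      intro i
      have hlt : z i.castSucc < z i.succ := z.strictMono (Fin.castSucc_lt_succ)
      have hsub : Icc (z i.castSucc) (z i.succ) ⊆ Icc a b :=
        Icc_subset_Icc (hz _).1.1 (hz _).1.2
      obtain ⟨y, hy, hy0⟩ := exists_deriv_eq_zero hlt (hh.continuousOn.mono hsub)
        ((hz _).2.trans (hz _).2.symm)
      refine ⟨y, hy, ?_⟩
      rw [derivWithin_of_mem_nhds, hy0]
      exact Icc_mem_nhds ((hz _).1.1.trans_lt hy.1) (hy.2.trans_le (hz _).1.2)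
    choose y hy hy0 using key
    have hmono : StrictMono y := by
      refine Fin.strictMono_iff_lt_succ.2 fun i => ?_
      exact (hy _).2.trans (by simpa using (hy i.succ).1)
    have hd : ContDiffOn ℝ m (derivWithin h (Icc a b)) (Icc a b) :=
      hh.derivWithin (uniqueDiffOn_Icc hab) (by norm_cast)
    obtain ⟨ξ, hξ, h0⟩ := ih (derivWithin h (Icc a b)) hd (Finset.univ.image y) (by
      intro w hw
      obtain ⟨i, -, rfl⟩ := Finset.mem_image.1 hw
      exact ⟨⟨(hz _).1.1.trans (hy i).1.le, (hy i).2.le.trans (hz _).1.2⟩, hy0 i⟩)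
      (by rw [Finset.card_image_of_injective _ hmono.injective]; simp)
    exact ⟨ξ, hξ, by rw [iteratedDerivWithin_succ']; exact h0⟩

theorem contDiff_eval (Q : ℝ[X]) {n : WithTop ℕ∞} : ContDiff ℝ n fun t => Q.eval t := by
  simpa using Q.contDiff_aeval (𝕜 := ℝ) n

theorem iteratedDerivWithin_eval {s : Set ℝ} (hs : UniqueDiffOn ℝ s) (n : ℕ) (P : ℝ[X]) {x : ℝ}
    (hx : x ∈ s) :
    iteratedDerivWithin n (fun t => P.eval t) s x = (derivative^[n] P).eval x := by
  induction n generalizing P with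
  | zero => simp
  | succ n ih =>
    rw [iteratedDerivWithin_succ', Function.iterate_succ_apply, ← ih]
    refine iteratedDerivWithin_congr (fun y hy => ?_) hx
    exact P.derivWithin (hs y hy)

theorem iterate_derivative_eq_C {k : ℕ} {Q : ℝ[X]} (hQ : Q.natDegree ≤ k) :
    derivative^[k] Q = C ((k.factorial : ℝ) * Q.coeff k) := by
  ext i
  rw [coeff_iterate_derivative, coeff_C]
  rcases Nat.eq_zero_or_pos i with rfl | hi
  · simp [Nat.descFactorial_self]
  · rw [coeff_eq_zero_of_natDegree_lt (by omega), if_neg hi.ne', smul_zero]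

/-- Serves two purposes: in degree exactly k it identifies the interpolation remainder, and in
degree < k the correction vanishes, so that f - P has the k-th derivative of f. -/
theorem iteratedDerivWithin_sub_eval {a b : ℝ} (hab : a < b) {k : ℕ} {f : ℝ → ℝ}
    (hf : ContDiffOn ℝ k f (Icc a b)) {Q : ℝ[X]} (hQ : Q.natDegree ≤ k) {x : ℝ}
    (hx : x ∈ Icc a b) :
    iteratedDerivWithin k (fun t => f t - Q.eval t) (Icc a b) x =
      iteratedDerivWithin k f (Icc a b) x - k.factorial * Q.coeff k := by
  have h1 := iteratedDerivWithin_sub hx (uniqueDiffOn_Icc hab) (hf x hx)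
    ((contDiff_eval Q).contDiffWithinAt : ContDiffWithinAt ℝ k (fun t => Q.eval t) (Icc a b) x)
  rw [iteratedDerivWithin_eval (uniqueDiffOn_Icc hab) k Q hx, iterate_derivative_eq_C hQ,
    eval_C] at h1
  exact h1

/-- Lagrange's formula is exact below degree `F.card`. The nodes are indexed through `v` because
both integers and equally spaced reals serve as nodes. -/
theorem eval_eq_sum_of_degree_lt {ι : Type*} [DecidableEq ι] {F : Finset ι} {v : ι → ℝ}
    (hv : Set.InjOn v F) {P : ℝ[X]} (hP : P.degree < F.card) (t : ℝ) :
    P.eval t = ∑ x ∈ F, P.eval (v x) * ∏ y ∈ F.erase x, (t - v y) / (v x - v y) := by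
  conv_lhs => rw [Lagrange.eq_interpolate hv hP]
  rw [Lagrange.interpolate_apply, eval_finsetSum]
  refine Finset.sum_congr rfl fun x _ => ?_
  rw [eval_mul, eval_C, Lagrange.basis, eval_prod]
  congr 1
  refine Finset.prod_congr rfl fun y _ => ?_
  simp [Lagrange.basisDivisor, div_eq_inv_mul]

/-- Lagrange interpolation with remainder, relative to a polynomial of degree `< k`. -/
theorem exists_sub_eval_eq_sum_add {ι : Type*} [DecidableEq ι] {a b : ℝ} (hab : a < b) {k : ℕ}
    {f : ℝ → ℝ} (hf : ContDiffOn ℝ k f (Icc a b)) {P : ℝ[X]} (hP : P.degree < k) {F : Finset ι}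
    {v : ι → ℝ} (hv : Set.InjOn v F) (hF : ∀ x ∈ F, v x ∈ Icc a b) (hcard : F.card = k) {t : ℝ}
    (ht : t ∈ Icc a b) (htF : ∀ x ∈ F, t ≠ v x) :
    ∃ ξ ∈ Icc a b, f t - P.eval t =
      ∑ x ∈ F, (f (v x) - P.eval (v x)) * ∏ y ∈ F.erase x, (t - v y) / (v x - v y) +
        iteratedDerivWithin k f (Icc a b) ξ / k.factorial * ∏ y ∈ F, (t - v y) := by
  set I : ℝ[X] := Lagrange.interpolate F v (fun x => f (v x)) with hI
  have hId : I.degree < F.card := Lagrange.degree_interpolate_lt _ hv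
  set w : ℝ[X] := Lagrange.nodal F v with hw
  have hwt : w.eval t = ∏ y ∈ F, (t - v y) := by simp [hw, Lagrange.eval_nodal]
  have hw0 : w.eval t ≠ 0 := by
    rw [hwt]
    exact Finset.prod_ne_zero_iff.2 fun y hy => sub_ne_zero.2 (htF y hy)
  -- This value makes f - I - A·w vanish at t as well, giving k + 1 zeros; A is the leading
  -- coefficient of I + A·w, so Rolle yields f^(k)(ξ) = k!·A.
  set A : ℝ := (f t - I.eval t) / w.eval t with hA
  have hQd : (I + C A * w).natDegree ≤ k := by
    refine (natDegree_add_le _ _).trans (max_le ?_ ?_)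
    · exact natDegree_le_of_degree_le (by rw [← hcard]; exact hId.le)
    · refine (natDegree_C_mul_le _ _).trans ?_
      rw [hw, Lagrange.natDegree_nodal, hcard]
  have hQc : (I + C A * w).coeff k = A := by
    have h1 : I.coeff k = 0 := coeff_eq_zero_of_degree_lt (by rw [← hcard]; exact hId)
    have h2 : w.coeff k = 1 := by
      have := (Lagrange.nodal_monic (s := F) (v := v))
      rwa [Monic, leadingCoeff, Lagrange.natDegree_nodal, hcard] at this
    simp [h1, h2]
  have hIx : ∀ x ∈ F, I.eval (v x) = f (v x) := fun x hx =>
    Lagrange.eval_interpolate_at_node (fun x => f (v x)) hv hx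
  obtain ⟨ξ, hξ, h0⟩ := exists_iteratedDerivWithin_eq_zero hab k
    (fun x => f x - (I + C A * w).eval x) (hf.sub (contDiff_eval _).contDiffOn)
    (insert t (F.image v)) (by
      intro z hz
      rcases Finset.mem_insert.1 hz with rfl | hz
      · refine ⟨ht, ?_⟩
        simp only [eval_add, eval_mul, eval_C, hA]
        field_simp
        ring
      · obtain ⟨x, hx, rfl⟩ := Finset.mem_image.1 hz
        refine ⟨hF x hx, ?_⟩
        have h2 : w.eval (v x) = 0 := Lagrange.eval_nodal_at_node hx
        simp [hIx x hx, h2])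
    (by
      rw [Finset.card_insert_of_notMem, Finset.card_image_of_injOn hv, hcard]
      rintro hmem
      obtain ⟨x, hx, hxt⟩ := Finset.mem_image.1 hmem
      exact htF x hx hxt.symm)
  refine ⟨ξ, hξ, ?_⟩
  rw [iteratedDerivWithin_sub_eval hab hf hQd hξ, hQc, sub_eq_zero] at h0
  have hfac : (k.factorial : ℝ) ≠ 0 := by positivity
  have hIt := eval_eq_sum_of_degree_lt hv hId t
  -- P is its own interpolant; subtracting its formula replaces the values of f at the nodes by
  -- those of f - P.
  have hPt := eval_eq_sum_of_degree_lt hv (P := P) (by rw [hcard]; exact hP) t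
  have hft : f t = I.eval t + A * w.eval t := by rw [hA]; field_simp; ring
  rw [h0, ← hwt, mul_div_cancel_left₀ _ hfac, hft, hIt, hPt]
  simp only [sub_mul, Finset.sum_sub_distrib]
  rw [Finset.sum_congr rfl fun x hx => by rw [hIx x hx]]
  ring

/-! ### Points between which f - P stays small -/

/-- If `f^{(k)}` has no zero then `f - P` stays small between enough of the points where it is
small: some `1/k`-th of the points of `G` spans an interval on which `|f - P| < δ`. -/
theorem exists_subset_small_on_hull {a b : ℝ} (hab : a < b) {k : ℕ} (hk : 1 ≤ k) {f : ℝ → ℝ}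
    (hf : ContDiffOn ℝ k f (Icc a b))
    (hf0 : ∀ x ∈ Icc a b, iteratedDerivWithin k f (Icc a b) x ≠ 0) {P : ℝ[X]}
    (hP : P.degree < k) {δ : ℝ} (G : Finset ℤ)
    (hG : ∀ n ∈ G, (n : ℝ) ∈ Icc a b ∧ |f n - P.eval (n : ℝ)| < δ) :
    ∃ B ⊆ G, G.card ≤ k * B.card ∧
      ∀ m ∈ B, ∀ n ∈ B, ∀ x ∈ Icc (m : ℝ) (n : ℝ), |f x - P.eval x| < δ := by
  classical
  obtain ⟨k, rfl⟩ : ∃ j, k = j + 1 := ⟨k - 1, by omega⟩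
  set g : ℝ → ℝ := fun x => f x - P.eval x with hg
  have hgc : ContDiffOn ℝ (k + 1 : ℕ) g (Icc a b) := hf.sub (contDiff_eval P).contDiffOn
  have hd : ContDiffOn ℝ k (derivWithin g (Icc a b)) (Icc a b) :=
    hgc.derivWithin (uniqueDiffOn_Icc hab) (by norm_cast)
  set S : Set ℝ := {x | x ∈ Icc a b ∧ derivWithin g (Icc a b) x = 0} with hS
  -- After the shift of k by one, k + 1 critical points of g would give a zero of g^(k+1) = f^(k+1).
  have hsmall : ∀ Z : Finset ℝ, (Z : Set ℝ) ⊆ S → Z.card ≤ k := by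
    intro Z hZ
    by_contra! hlt
    obtain ⟨ξ, hξ, h0⟩ := exists_iteratedDerivWithin_eq_zero hab k _ hd Z
      (fun z hz => hZ hz) hlt
    rw [← iteratedDerivWithin_succ', iteratedDerivWithin_sub_eval hab hf
      (natDegree_le_of_degree_le hP.le) hξ, coeff_eq_zero_of_degree_lt hP, mul_zero,
      sub_zero] at h0
    exact hf0 ξ hξ h0
  have hfin : S.Finite := by
    by_contra hinf
    obtain ⟨Z, hZ, hc⟩ := Set.Infinite.exists_subset_card_eq hinf (k + 1)
    have := hsmall Z hZ
    omega
  set Z := hfin.toFinset with hZdef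
  have hZ : Z.card ≤ k := hsmall Z (by simp [hZdef])
  -- Classify the points by the number of critical points to their left: at most k + 1 classes, and
  -- no critical point lies strictly between two members of a class.
  set φ : ℤ → ℕ := fun n => (Z.filter fun z => z < (n : ℝ)).card with hφ
  have hmaps : ∀ n ∈ G, φ n ∈ Finset.range (k + 1) := fun n _ =>
    Finset.mem_range.2 (Nat.lt_succ_of_le ((Finset.card_filter_le _ _).trans hZ))
  obtain ⟨i, -, hi⟩ : ∃ i ∈ Finset.range (k + 1),
      G.card ≤ (k + 1) * (G.filter fun n => φ n = i).card := by
    by_contra! hcon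
    have h1 := Finset.card_eq_sum_card_fiberwise (s := G) (t := Finset.range (k + 1)) (f := φ)
      (fun n hn => hmaps n hn)
    have h2 : (k + 1) * G.card = ∑ i ∈ Finset.range (k + 1),
        (k + 1) * (G.filter fun n => φ n = i).card := by rw [h1, Finset.mul_sum]
    have h3 := Finset.sum_lt_sum_of_nonempty (s := Finset.range (k + 1)) (by simp) hcon
    rw [← h2] at h3
    simp at h3
  refine ⟨_, Finset.filter_subset _ _, hi, ?_⟩
  intro m hm n hn x hx
  rw [Finset.mem_filter] at hm hn
  by_contra! hge
  have hm' := hG m hm.1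
  have hn' := hG n hn.1
  have hmx : (m : ℝ) ≠ x := fun h => by
    rw [← h] at hge; linarith [hm'.2]
  have hxn : x ≠ n := fun h => by
    rw [h] at hge; linarith [hn'.2]
  have hmlt : (m : ℝ) < x := lt_of_le_of_ne hx.1 hmx
  have hltn : x < n := lt_of_le_of_ne hx.2 hxn
  have hsub : Icc (m : ℝ) n ⊆ Icc a b := Icc_subset_Icc hm'.1.1 hn'.1.2
  have hcont : ContinuousOn g (Icc (m : ℝ) n) := hgc.continuousOn.mono hsub
  -- With |g| < δ at both ends and |g(x)| ≥ δ inside, an extremum is attained in the interior; this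
  -- critical point separates m from n, against equality of φ.
  obtain ⟨y, hy, hext⟩ : ∃ y ∈ Ioo (m : ℝ) n, IsLocalExtr g y := by
    have hne : (Icc (m : ℝ) n).Nonempty := ⟨x, hx⟩
    rcases le_abs'.1 hge with hneg | hpos
    · obtain ⟨y, hy, hmin⟩ := isCompact_Icc.exists_isMinOn hne hcont
      have hyx : g y ≤ g x := hmin hx
      have h1 := (abs_lt.1 hm'.2).1
      have h2 := (abs_lt.1 hn'.2).1
      have hy1 : y ≠ m := by rintro rfl; simp only [hg] at hyx; linarith
      have hy2 : y ≠ n := by rintro rfl; simp only [hg] at hyx; linarith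
      have hyI : y ∈ Ioo (m : ℝ) n :=
        ⟨lt_of_le_of_ne hy.1 hy1.symm, lt_of_le_of_ne hy.2 hy2⟩
      exact ⟨y, hyI, Or.inl (hmin.isLocalMin (Icc_mem_nhds hyI.1 hyI.2))⟩
    · obtain ⟨y, hy, hmax⟩ := isCompact_Icc.exists_isMaxOn hne hcont
      have hyx : g x ≤ g y := hmax hx
      have h1 := (abs_lt.1 hm'.2).2
      have h2 := (abs_lt.1 hn'.2).2
      have hy1 : y ≠ m := by rintro rfl; simp only [hg] at hyx; linarith
      have hy2 : y ≠ n := by rintro rfl; simp only [hg] at hyx; linarith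
      have hyI : y ∈ Ioo (m : ℝ) n :=
        ⟨lt_of_le_of_ne hy.1 hy1.symm, lt_of_le_of_ne hy.2 hy2⟩
      exact ⟨y, hyI, Or.inr (hmax.isLocalMax (Icc_mem_nhds hyI.1 hyI.2))⟩
  have hyab : y ∈ Icc a b := hsub ⟨hy.1.le, hy.2.le⟩
  have hyZ : y ∈ Z := by
    rw [hZdef, Set.Finite.mem_toFinset]
    refine ⟨hyab, ?_⟩
    rw [derivWithin_of_mem_nhds (Icc_mem_nhds (hm'.1.1.trans_lt hy.1) (hy.2.trans_le hn'.1.2))]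
    exact hext.deriv_eq_zero
  have hlt : φ m < φ n := by
    refine Finset.card_lt_card ((Finset.ssubset_iff_of_subset ?_).2 ⟨y, ?_, ?_⟩)
    · intro z hz
      rw [Finset.mem_filter] at hz ⊢
      exact ⟨hz.1, hz.2.trans (hmlt.trans hltn)⟩
    · exact Finset.mem_filter.2 ⟨hyZ, hy.2⟩
    · simp [hy.1.le]
  omega

/-! ### Products of differences as denominators -/

/-- The product of the differences `y - x` over all `x < y` in `F`. -/
def pairProd (F : Finset ℤ) : ℤ := ∏ x ∈ F, ∏ y ∈ F, if x < y then y - x else 1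

theorem pairProd_pos (F : Finset ℤ) : 0 < pairProd F := by
  refine Finset.prod_pos fun x _ => Finset.prod_pos fun y _ => ?_
  split_ifs with h <;> omega

theorem pairProd_insert {F : Finset ℤ} {a : ℤ} (ha : a ∉ F) :
    pairProd (insert a F) = pairProd F * ∏ y ∈ F, |a - y| := by
  unfold pairProd
  rw [Finset.prod_insert ha]
  simp_rw [Finset.prod_insert ha]
  rw [Finset.prod_mul_distrib, if_neg (lt_irrefl a), one_mul, ← mul_assoc,
    ← Finset.prod_mul_distrib, mul_comm]
  congr 1
  refine Finset.prod_congr rfl fun y hy => ?_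
  have hne : a ≠ y := fun h => ha (h ▸ hy)
  rcases lt_or_gt_of_ne hne with h | h
  · rw [if_pos h, if_neg h.not_gt, mul_one, abs_of_neg (by omega)]
    ring
  · rw [if_neg h.not_gt, if_pos h, one_mul, abs_of_pos (by omega)]

theorem pairProd_erase {F : Finset ℤ} {a : ℤ} (ha : a ∈ F) :
    pairProd F = pairProd (F.erase a) * ∏ y ∈ F.erase a, |a - y| := by
  rw [← pairProd_insert (Finset.notMem_erase a F), Finset.insert_erase ha]

theorem prod_abs_le_pow_card {ι : Type*} {s : Finset ι} {w : ι → ℝ} {D : ℝ}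
    (h : ∀ i ∈ s, |w i| ≤ D) : ∏ i ∈ s, |w i| ≤ D ^ s.card :=
  (Finset.prod_le_prod (fun _ _ => abs_nonneg _) h).trans_eq (Finset.prod_const D)

theorem pairProd_le {F : Finset ℤ} {D : ℝ} (hD : 0 ≤ D)
    (hF : ∀ x ∈ F, ∀ y ∈ F, |(x : ℝ) - y| ≤ D) :
    (pairProd F : ℝ) ≤ D ^ (F.card.choose 2) := by
  induction F using Finset.induction_on with
  | empty => simp [pairProd]
  | insert a F ha ih =>
    rw [pairProd_insert ha, Finset.card_insert_of_notMem ha, Nat.choose_succ_succ' F.card 1,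
      Nat.choose_one_right, pow_add, mul_comm (D ^ F.card)]
    push_cast
    have h1 : (pairProd F : ℝ) ≤ D ^ (F.card.choose 2) := ih fun x hx y hy =>
      hF x (Finset.mem_insert_of_mem hx) y (Finset.mem_insert_of_mem hy)
    have h2 : ∏ y ∈ F, |(a : ℝ) - y| ≤ D ^ F.card :=
      prod_abs_le_pow_card fun y hy =>
        hF a (Finset.mem_insert_self _ _) y (Finset.mem_insert_of_mem hy)
    exact mul_le_mul h1 h2 (Finset.prod_nonneg fun _ _ => abs_nonneg _) (by positivity)

theorem intCast_injOn (F : Finset ℤ) : Set.InjOn (fun n : ℤ => (n : ℝ)) F :=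
  Int.cast_injective.injOn

/-- A polynomial of degree `< k` that is integral at the `k` points of `F` has values with
denominator dividing `pairProd F`. -/
theorem exists_pairProd_mul_eval {F : Finset ℤ} {P : ℝ[X]} (hP : P.degree < F.card)
    (hF : ∀ x ∈ F, ∃ z : ℤ, P.eval (x : ℝ) = z) (n : ℤ) :
    ∃ z : ℤ, (pairProd F : ℝ) * P.eval (n : ℝ) = z := by
  rw [eval_eq_sum_of_degree_lt (intCast_injOn F) hP, Finset.mul_sum]
  have : ∀ x ∈ F, ∃ z : ℤ, (pairProd F : ℝ) * (P.eval (x : ℝ) *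
      ∏ y ∈ F.erase x, ((n : ℝ) - y) / (x - y)) = z := by
    intro x hx
    obtain ⟨z, hz⟩ := hF x hx
    -- The factors |x - y| of `pairProd F` cancel the denominators of the Lagrange basis up to
    -- signs.
    refine ⟨pairProd (F.erase x) * z * ∏ y ∈ F.erase x, (SignType.sign (x - y) : ℤ) * (n - y), ?_⟩
    rw [pairProd_erase hx, hz]
    push_cast
    rw [mul_assoc, mul_assoc, mul_left_comm _ (z : ℝ), ← Finset.prod_mul_distrib]
    congr 2
    refine Finset.prod_congr rfl fun y hy => ?_
    have hne : (x : ℝ) - y ≠ 0 :=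
      sub_ne_zero.2 (by exact_mod_cast (Finset.ne_of_mem_erase hy).symm)
    have hs : |(x : ℝ) - y| = ((SignType.sign (x - y) : ℤ) : ℝ) * (x - y) := by
      have := (sign_mul_self (x - y)).symm
      have h2 : ((|x - y| : ℤ) : ℝ) = (((SignType.sign (x - y) : ℤ) * (x - y) : ℤ) : ℝ) := by
        exact_mod_cast congrArg (Int.cast : ℤ → ℝ) this
      push_cast at h2 ⊢
      exact h2
    rw [hs]
    field_simp
    push_cast
    ring
  choose! z hz using this
  exact ⟨∑ x ∈ F, z x, by rw [Finset.sum_congr rfl hz]; push_cast; rfl⟩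

/-- Points that are not on a common curve of degree `< k` cannot be too close together. -/
theorem one_le_of_eval_ne {a b : ℝ} (hab : a < b) {k : ℕ} {f : ℝ → ℝ}
    (hf : ContDiffOn ℝ k f (Icc a b)) {Λ : ℝ}
    (hΛ : ∀ x ∈ Icc a b, |iteratedDerivWithin k f (Icc a b) x| ≤ Λ) {P : ℝ[X]}
    (hP : P.degree < k) {F : Finset ℤ} (hcard : F.card = k) {m : ℤ → ℤ} {δ D : ℝ} (hD : 0 ≤ D)
    {t : ℤ} (htF : t ∉ F)
    (hmem : ∀ n ∈ insert t F, (n : ℝ) ∈ Icc a b ∧ |f n - m n| ≤ δ)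
    (hdist : ∀ x ∈ insert t F, ∀ y ∈ insert t F, |(x : ℝ) - y| ≤ D)
    (hPF : ∀ n ∈ F, P.eval (n : ℝ) = m n) (hPt : P.eval (t : ℝ) ≠ m t) :
    1 ≤ (k + 1) * δ * D ^ (k.choose 2) + Λ / k.factorial * D ^ ((k + 1).choose 2) := by
  have hV : (0 : ℝ) < pairProd F := by exact_mod_cast pairProd_pos F
  obtain ⟨z, hz⟩ := exists_pairProd_mul_eval (by rw [hcard]; exact hP)
    (fun x hx => ⟨m x, hPF x hx⟩) t
  -- After multiplication by `pairProd F` the gap is the absolute value of a nonzero integer.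
  have hone : 1 ≤ (pairProd F : ℝ) * |P.eval (t : ℝ) - m t| := by
    rw [← abs_of_pos hV, ← abs_mul, mul_sub, hz]
    have hne : z - pairProd F * m t ≠ 0 := by
      intro h
      apply hPt
      have : (z : ℝ) = pairProd F * m t := by exact_mod_cast sub_eq_zero.1 h
      exact mul_left_cancel₀ hV.ne' (hz.trans this)
    exact_mod_cast Int.one_le_abs hne
  have ht := hmem t (Finset.mem_insert_self _ _)
  have hFm : ∀ n ∈ F, (n : ℝ) ∈ Icc a b ∧ |f n - m n| ≤ δ := fun n hn =>
    hmem n (Finset.mem_insert_of_mem hn)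
  obtain ⟨ξ, hξ, heq⟩ := exists_sub_eval_eq_sum_add hab hf hP (intCast_injOn F)
    (fun x hx => (hFm x hx).1) hcard ht.1
    (fun x hx h => htF (by rw [Int.cast_injective h]; exact hx))
  have hsub : ∀ {G : Finset ℤ}, G ⊆ insert t F → (pairProd G : ℝ) ≤ D ^ (G.card.choose 2) :=
    fun {G} hG => pairProd_le hD fun x hx y hy => hdist x (hG hx) y (hG hy)
  have hΛ0 : 0 ≤ Λ := (abs_nonneg _).trans (hΛ ξ hξ)
  have hδ0 : 0 ≤ δ := (abs_nonneg _).trans ht.2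
  have hlast : (pairProd F : ℝ) * |iteratedDerivWithin k f (Icc a b) ξ / k.factorial *
      ∏ y ∈ F, ((t : ℝ) - y)| ≤ Λ / k.factorial * D ^ ((k + 1).choose 2) := by
    have h1 := hsub (Finset.Subset.refl (insert t F))
    rw [pairProd_insert htF, Finset.card_insert_of_notMem htF, hcard] at h1
    push_cast at h1
    rw [abs_mul, abs_div, Nat.abs_cast, Finset.abs_prod, mul_left_comm]
    refine mul_le_mul ?_ h1 (by positivity) (by positivity)
    gcongr
    exact hΛ ξ hξ
  have hsum : (pairProd F : ℝ) * |∑ x ∈ F, (f x - P.eval (x : ℝ)) *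
      ∏ y ∈ F.erase x, ((t : ℝ) - y) / (x - y)| ≤ k * (δ * D ^ (k.choose 2)) := by
    have hterm : ∀ x ∈ F, (pairProd F : ℝ) * |(f x - P.eval (x : ℝ)) *
        ∏ y ∈ F.erase x, ((t : ℝ) - y) / (x - y)| ≤ δ * D ^ (k.choose 2) := by
      intro x hx
      have hte : t ∉ F.erase x := fun h => htF (Finset.mem_of_mem_erase h)
      have h1 := hsub (Finset.insert_subset_insert t (Finset.erase_subset x F))
      rw [pairProd_insert hte, Finset.card_insert_of_notMem hte, Finset.card_erase_add_one hx,
        hcard] at h1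
      push_cast at h1
      -- The basis factor exchanges x for t: the result is the product of differences of another
      -- k-point set, so it is still at most D^(k choose 2).
      have h2 : (pairProd F : ℝ) * ∏ y ∈ F.erase x, |((t : ℝ) - y) / (x - y)| =
          pairProd (F.erase x) * ∏ y ∈ F.erase x, |(t : ℝ) - y| := by
        rw [pairProd_erase hx]
        push_cast
        rw [mul_assoc, ← Finset.prod_mul_distrib]
        congr 1
        refine Finset.prod_congr rfl fun y hy => ?_
        have hne : |(x : ℝ) - y| ≠ 0 :=
          abs_ne_zero.2 (sub_ne_zero.2 (by exact_mod_cast (Finset.ne_of_mem_erase hy).symm))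
        rw [abs_div]
        field_simp
      rw [abs_mul, Finset.abs_prod, mul_left_comm, h2, hPF x hx]
      exact mul_le_mul (hFm x hx).2 h1
        (mul_nonneg (by exact_mod_cast (pairProd_pos _).le) (by positivity)) hδ0
    calc _ ≤ (pairProd F : ℝ) * ∑ x ∈ F, |(f x - P.eval (x : ℝ)) *
          ∏ y ∈ F.erase x, ((t : ℝ) - y) / (x - y)| := by
            gcongr
            exact Finset.abs_sum_le_sum_abs _ _
      _ ≤ ∑ x ∈ F, δ * D ^ (k.choose 2) := by
            rw [Finset.mul_sum]
            exact Finset.sum_le_sum hterm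
      _ = _ := by rw [Finset.sum_const, hcard, nsmul_eq_mul]
  have hVle : (pairProd F : ℝ) ≤ D ^ (k.choose 2) := by
    have := hsub (Finset.subset_insert t F)
    rwa [hcard] at this
  have htri : |P.eval (t : ℝ) - m t| ≤ δ + |f t - P.eval (t : ℝ)| := by
    have h1 : P.eval (t : ℝ) - m t = (f t - m t) - (f t - P.eval (t : ℝ)) := by ring
    rw [h1]
    exact (abs_sub _ _).trans (add_le_add_left ht.2 _)
  calc (1 : ℝ) ≤ (pairProd F : ℝ) * |P.eval (t : ℝ) - m t| := hone
    _ ≤ (pairProd F : ℝ) * (δ + |f t - P.eval (t : ℝ)|) := by gcongr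
    _ ≤ (pairProd F : ℝ) * (δ + (|∑ x ∈ F, (f x - P.eval (x : ℝ)) *
          ∏ y ∈ F.erase x, ((t : ℝ) - y) / (x - y)| +
          |iteratedDerivWithin k f (Icc a b) ξ / k.factorial * ∏ y ∈ F, ((t : ℝ) - y)|)) := by
        rw [heq]
        gcongr
        exact abs_add_le _ _
    _ ≤ D ^ (k.choose 2) * δ + (k * (δ * D ^ (k.choose 2)) +
          Λ / k.factorial * D ^ ((k + 1).choose 2)) := by
        rw [mul_add, mul_add]
        gcongr
    _ = _ := by ring

/-- If any `k` points of `B` contain two points at distance at least `σ`, then `B` has few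
elements in an interval of length `L`. -/
theorem card_le_of_spread {B : Finset ℤ} {k : ℕ} (hk : 1 ≤ k) {u L σ : ℝ} (hσ : 0 < σ)
    (hB : ∀ n ∈ B, (n : ℝ) ∈ Icc u (u + L)) (hL : 0 ≤ L)
    (hspread : ∀ F ⊆ B, F.card = k → ∃ x ∈ F, ∃ y ∈ F, σ ≤ (y : ℝ) - x) :
    (B.card : ℝ) ≤ (k - 1) * (L / σ + 1) := by
  have hcell : B.card ≤ (k - 1) * (Finset.range (⌊L / σ⌋₊ + 1)).card := by
    -- Cut the interval into half-open cells of length σ; each holds at most k - 1 points, since k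
    -- points in one cell would have spread less than σ.
    refine Finset.card_le_mul_card_image_of_maps_to
      (f := fun n : ℤ => ⌊((n : ℝ) - u) / σ⌋₊) ?_ _ ?_
    · intro n hn
      refine Finset.mem_range.2 (Nat.lt_succ_of_le (Nat.floor_le_floor ?_))
      have := (hB n hn).2
      gcongr
      linarith
    · intro i _
      by_contra! hlt
      obtain ⟨F, hF, hFc⟩ := Finset.exists_subset_card_eq (n := k) (by omega :
        k ≤ (B.filter fun n : ℤ => ⌊((n : ℝ) - u) / σ⌋₊ = i).card)
      obtain ⟨x, hx, y, hy, hxy⟩ := hspread F (hF.trans (Finset.filter_subset _ _)) hFc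
      obtain ⟨hxB, hxi⟩ := Finset.mem_filter.1 (hF hx)
      obtain ⟨hyB, hyi⟩ := Finset.mem_filter.1 (hF hy)
      have h1 := Nat.lt_floor_add_one (((y : ℝ) - u) / σ)
      have h2 := Nat.floor_le (div_nonneg (sub_nonneg.2 (hB x hxB).1) hσ.le)
      rw [hyi, div_lt_iff₀ hσ] at h1
      rw [hxi, le_div_iff₀ hσ] at h2
      linarith
  rw [Finset.card_range] at hcell
  have h3 : (B.card : ℝ) ≤ ((k - 1 : ℕ) : ℝ) * (⌊L / σ⌋₊ + 1) := by exact_mod_cast hcell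
  rw [Nat.cast_sub hk, Nat.cast_one] at h3
  refine h3.trans ?_
  have hk' : (1 : ℝ) ≤ k := by exact_mod_cast hk
  have := Nat.floor_le (div_nonneg hL hσ.le)
  exact mul_le_mul_of_nonneg_left (by linarith) (by linarith)

/-! ### Arc lengths and growth, by equally spaced nodes -/

/-- The sum in the interpolation formula at `k` equally spaced nodes. -/
theorem abs_sum_equispaced_le {k : ℕ} (hk : 1 ≤ k) {g : ℝ → ℝ} {u L δ t D : ℝ} (hL : 0 < L)
    (hD : 0 ≤ D) (hg : ∀ x ∈ Icc u (u + L), |g x| ≤ δ)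
    (ht : ∀ x ∈ Icc u (u + L), |t - x| ≤ D) :
    |∑ i ∈ Finset.range k, g (u + i * (L / k)) * ∏ j ∈ (Finset.range k).erase i,
      (t - (u + j * (L / k))) / ((u + i * (L / k)) - (u + j * (L / k)))| ≤
      k * (δ * (k * (D / L)) ^ (k - 1)) := by
  have hk0 : (0 : ℝ) < k := by exact_mod_cast hk
  have hnode : ∀ i ∈ Finset.range k, u + i * (L / k) ∈ Icc u (u + L) := by
    intro i hi
    have hik : (i : ℝ) ≤ k := by exact_mod_cast (Finset.mem_range.1 hi).le
    refine ⟨by have : 0 ≤ (i : ℝ) * (L / k) := by positivity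
               linarith, ?_⟩
    have : (i : ℝ) * (L / k) ≤ k * (L / k) := by gcongr
    rw [mul_div_cancel₀ _ hk0.ne'] at this
    linarith
  have hδ0 : 0 ≤ δ := (abs_nonneg _).trans (hg u ⟨le_rfl, by linarith⟩)
  refine (Finset.abs_sum_le_sum_abs _ _).trans ?_
  refine (Finset.sum_le_card_nsmul _ _ (δ * (k * (D / L)) ^ (k - 1)) fun i hi => ?_).trans
    (by rw [Finset.card_range, nsmul_eq_mul])
  rw [abs_mul, Finset.abs_prod]
  refine mul_le_mul (hg _ (hnode i hi)) ?_ (Finset.prod_nonneg fun _ _ => abs_nonneg _) hδ0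
  have hc : ((Finset.range k).erase i).card = k - 1 := by
    rw [Finset.card_erase_of_mem hi, Finset.card_range]
  rw [← hc]
  refine prod_abs_le_pow_card fun j hj => ?_
  -- Distinct nodes are at least L/k apart, so each of the k - 1 factors is at most kD/L.
  have hij : (1 : ℝ) ≤ |(i : ℝ) - j| := by
    have : (i : ℤ) - j ≠ 0 := by
      have := Finset.ne_of_mem_erase hj
      omega
    exact_mod_cast Int.one_le_abs this
  have hden : L / k ≤ |(u + i * (L / k)) - (u + j * (L / k))| := by
    have h1 : (u + i * (L / k)) - (u + j * (L / k)) = ((i : ℝ) - j) * (L / k) := by ring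
    have h2 : 0 < L / k := by positivity
    rw [h1, abs_mul, abs_of_pos h2]
    exact le_mul_of_one_le_left h2.le hij
  rw [abs_div]
  calc _ ≤ D / (L / k) := by
        gcongr
        exact ht _ (hnode j (Finset.mem_of_mem_erase hj))
    _ = _ := by field_simp

theorem equispaced_injOn {k : ℕ} {u L : ℝ} (hk : 1 ≤ k) (hL : 0 < L) :
    Set.InjOn (fun i : ℕ => u + i * (L / k)) (Finset.range k : Set ℕ) := by
  have hk0 : (0 : ℝ) < k := by exact_mod_cast hk
  have h2 : L / k ≠ 0 := by positivity
  intro i _ j _ h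
  exact_mod_cast mul_right_cancel₀ h2 (add_left_cancel h)

theorem equispaced_mem {k : ℕ} {u L : ℝ} (hk : 1 ≤ k) (hL : 0 < L) {i : ℕ}
    (hi : i ∈ Finset.range k) : u + i * (L / k) ∈ Ico u (u + L) := by
  have hk0 : (0 : ℝ) < k := by exact_mod_cast hk
  have hik : (i : ℝ) < k := by exact_mod_cast Finset.mem_range.1 hi
  have h0 : 0 ≤ (i : ℝ) * (L / k) := by positivity
  have : (i : ℝ) * (L / k) < k * (L / k) := by gcongr
  rw [mul_div_cancel₀ _ hk0.ne'] at this
  exact ⟨by linarith, by linarith⟩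

/-- An interval on which `f` is close to a polynomial of degree `< k` is short. -/
theorem mul_pow_le_of_small {a b : ℝ} (hab : a < b) {k : ℕ} (hk : 1 ≤ k) {f : ℝ → ℝ}
    (hf : ContDiffOn ℝ k f (Icc a b)) {lam : ℝ}
    (hlam : ∀ x ∈ Icc a b, lam ≤ |iteratedDerivWithin k f (Icc a b) x|) {P : ℝ[X]}
    (hP : P.degree < k) {u L δ : ℝ} (hL : 0 < L) (hsub : Icc u (u + L) ⊆ Icc a b)
    (hg : ∀ x ∈ Icc u (u + L), |f x - P.eval x| ≤ δ) :
    lam * L ^ k ≤ (2 * (k : ℝ) ^ 2) ^ k * δ := by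
  have hk0 : (0 : ℝ) < k := by exact_mod_cast hk
  have hk1 : (1 : ℝ) ≤ k := by exact_mod_cast hk
  have hend : u + L ∈ Icc u (u + L) := ⟨by linarith, le_rfl⟩
  have hδ0 : 0 ≤ δ := (abs_nonneg _).trans (hg _ hend)
  obtain ⟨ξ, hξ, heq⟩ := exists_sub_eval_eq_sum_add hab hf hP
    (equispaced_injOn (u := u) hk hL)
    (fun i hi => hsub (Ico_subset_Icc_self (equispaced_mem hk hL hi))) (Finset.card_range k)
    (hsub hend) (fun i hi => (equispaced_mem hk hL hi).2.ne')
  have hsum := abs_sum_equispaced_le (g := fun x => f x - P.eval x) hk hL hL.le hg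
    (fun x hx => by rw [abs_of_nonneg (by linarith [hx.2])]; linarith [hx.1] : ∀ x ∈ Icc u (u + L),
      |u + L - x| ≤ L)
  rw [div_self hL.ne', mul_one, mul_left_comm, mul_pow_sub_one (by omega)] at hsum
  -- The last node is u + (k-1)L/k, so from the right end u + L the distances are jL/k for j = 1, …,
  -- k; their k! cancels the factorial in the remainder.
  have hprod : ∏ i ∈ Finset.range k, (u + L - (u + i * (L / k))) =
      k.factorial * (L / k) ^ k := by
    rw [← Finset.prod_range_add_one_eq_factorial, ← Finset.prod_range_reflect]
    push_cast
    rw [← Finset.card_range k, ← Finset.prod_const, Finset.card_range,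
      ← Finset.prod_mul_distrib]
    refine Finset.prod_congr rfl fun i hi => ?_
    have hik := Finset.mem_range.1 hi
    have : ((k - 1 - i : ℕ) : ℝ) = k - 1 - i := by
      rw [Nat.cast_sub (by omega), Nat.cast_sub hk]; simp
    rw [this]
    field_simp
    ring
  rw [hprod, div_mul_eq_mul_div, mul_left_comm, mul_div_cancel_left₀ _ (by positivity)] at heq
  have h1 : lam * (L / k) ^ k ≤ δ + δ * (k : ℝ) ^ k := by
    calc lam * (L / k) ^ k ≤ |iteratedDerivWithin k f (Icc a b) ξ| * (L / k) ^ k := by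
          gcongr
          exact hlam ξ hξ
      _ = |iteratedDerivWithin k f (Icc a b) ξ * (L / k) ^ k| := by
          rw [abs_mul, abs_of_nonneg (by positivity : 0 ≤ (L / k) ^ k)]
      _ ≤ |f (u + L) - P.eval (u + L)| + δ * (k : ℝ) ^ k := by
          rw [eq_sub_of_add_eq' heq.symm]
          exact (abs_sub _ _).trans (add_le_add_right hsum _)
      _ ≤ _ := by gcongr; exact hg _ hend
  have hkk : (1 : ℝ) ≤ (k : ℝ) ^ k := one_le_pow₀ hk1
  have h2k : (2 : ℝ) ≤ 2 ^ k := by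
    simpa using pow_le_pow_right₀ (by norm_num : (1 : ℝ) ≤ 2) hk
  have h2 : lam * L ^ k = lam * (L / k) ^ k * (k : ℝ) ^ k := by
    rw [div_pow]; field_simp
  rw [h2, mul_pow, pow_right_comm, sq ((k : ℝ) ^ k)]
  calc lam * (L / k) ^ k * (k : ℝ) ^ k ≤ (δ + δ * (k : ℝ) ^ k) * (k : ℝ) ^ k := by gcongr
    _ ≤ (2 * (k : ℝ) ^ k * δ) * (k : ℝ) ^ k := by gcongr; nlinarith
    _ ≤ (2 ^ k * (k : ℝ) ^ k * δ) * (k : ℝ) ^ k := by gcongr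
    _ = _ := by ring

/-- `f - P` grows in a controlled way outside of an interval on which it is small. -/
theorem abs_sub_eval_le_of_small {a b : ℝ} (hab : a < b) {k : ℕ} (hk : 1 ≤ k) {f : ℝ → ℝ}
    (hf : ContDiffOn ℝ k f (Icc a b)) {lam c : ℝ} (hc : 1 ≤ c)
    (hlam : ∀ x ∈ Icc a b, lam ≤ |iteratedDerivWithin k f (Icc a b) x| ∧
      |iteratedDerivWithin k f (Icc a b) x| ≤ c * lam) {P : ℝ[X]}
    (hP : P.degree < k) {u L δ : ℝ} (hL : 0 < L) (hsub : Icc u (u + L) ⊆ Icc a b)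
    (hg : ∀ x ∈ Icc u (u + L), |f x - P.eval x| ≤ δ) {t : ℝ} (ht : t ∈ Icc a b)
    (hut : u + L ≤ t) :
    |f t - P.eval t| ≤ 2 * c * (2 * (k : ℝ) ^ 2) ^ k * δ * ((t - u) / L) ^ k := by
  have hk0 : (0 : ℝ) < k := by exact_mod_cast hk
  have hk1 : (1 : ℝ) ≤ k := by exact_mod_cast hk
  have hδ0 : 0 ≤ δ := (abs_nonneg _).trans (hg u ⟨le_rfl, by linarith⟩)
  have hD0 : 0 < t - u := by linarith
  obtain ⟨ξ, hξ, heq⟩ := exists_sub_eval_eq_sum_add hab hf hP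
    (equispaced_injOn (u := u) hk hL)
    (fun i hi => hsub (Ico_subset_Icc_self (equispaced_mem hk hL hi))) (Finset.card_range k)
    ht (fun i hi => ((equispaced_mem hk hL hi).2.trans_le hut).ne')
  have hsum := abs_sum_equispaced_le (g := fun x => f x - P.eval x) hk hL hD0.le hg
    (fun x hx => by rw [abs_of_nonneg (by linarith [hx.2])]; linarith [hx.1] : ∀ x ∈ Icc u (u + L),
      |t - x| ≤ t - u)
  set D := t - u with hD
  have hDL : 1 ≤ D / L := by rw [le_div_iff₀ hL]; linarith
  have hprod : |∏ i ∈ Finset.range k, (t - (u + i * (L / k)))| ≤ D ^ k := by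
    rw [Finset.abs_prod]
    conv_rhs => rw [← Finset.card_range k]
    refine prod_abs_le_pow_card fun i hi => ?_
    have := equispaced_mem (u := u) hk hL hi
    rw [abs_of_nonneg (by linarith [this.2])]
    linarith [this.1]
  -- The remainder involves λ; smallness of f - P on the interval trades λL^k for a multiple of δ.
  have hlk := mul_pow_le_of_small hab hk hf (fun x hx => (hlam x hx).1) hP hL hsub hg
  have hlam0 : 0 ≤ c * lam := (abs_nonneg _).trans (hlam ξ hξ).2
  have hfac : (1 : ℝ) ≤ k.factorial := by exact_mod_cast k.factorial_pos
  have hrem : |iteratedDerivWithin k f (Icc a b) ξ / k.factorial *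
      ∏ i ∈ Finset.range k, (t - (u + i * (L / k)))| ≤
      c * (2 * (k : ℝ) ^ 2) ^ k * δ * (D / L) ^ k := by
    rw [abs_mul, abs_div, Nat.abs_cast]
    calc _ ≤ (c * lam / 1) * D ^ k := by
          gcongr
          exact (hlam ξ hξ).2
      _ = c * (lam * L ^ k) * (D / L) ^ k := by rw [div_pow]; field_simp
      _ ≤ c * ((2 * (k : ℝ) ^ 2) ^ k * δ) * (D / L) ^ k := by gcongr
      _ = _ := by ring
  have hsum' : (k : ℝ) * (δ * (k * (D / L)) ^ (k - 1)) ≤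
      c * (2 * (k : ℝ) ^ 2) ^ k * δ * (D / L) ^ k := by
    calc (k : ℝ) * (δ * (k * (D / L)) ^ (k - 1))
        ≤ (k * (D / L)) * (δ * (k * (D / L)) ^ (k - 1)) := by
          gcongr
          exact le_mul_of_one_le_right hk0.le hDL
      _ = (k : ℝ) ^ k * δ * (D / L) ^ k := by
          rw [mul_left_comm, mul_pow_sub_one (by omega), mul_pow]; ring
      _ ≤ (2 * (k : ℝ) ^ 2) ^ k * δ * (D / L) ^ k := by
          gcongr
          nlinarith
      _ ≤ c * ((2 * (k : ℝ) ^ 2) ^ k * δ * (D / L) ^ k) :=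
          le_mul_of_one_le_left (by positivity) hc
      _ = _ := by ring
  rw [heq]
  refine (abs_add_le _ _).trans ((add_le_add (hsum.trans hsum') hrem).trans (le_of_eq ?_))
  ring

/-! ### Extraction of roots -/

theorem le_rpow_of_pow_le {x y : ℝ} (hx : 0 ≤ x) {r : ℕ} (hr : r ≠ 0)
    (h : x ^ r ≤ y) : x ≤ y ^ (1 / (r : ℝ)) := by
  have h1 := Real.rpow_le_rpow (by positivity) h (by positivity : (0 : ℝ) ≤ 1 / (r : ℝ))
  rwa [one_div, Real.pow_rpow_inv_natCast hx hr, ← one_div] at h1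

theorem rpow_le_of_le_pow {x y : ℝ} (hx : 0 ≤ x) (hy : 0 ≤ y) {r : ℕ} (hr : r ≠ 0)
    (h : x ≤ y ^ r) : x ^ (1 / (r : ℝ)) ≤ y := by
  have h1 := Real.rpow_le_rpow hx h (by positivity : (0 : ℝ) ≤ 1 / (r : ℝ))
  rwa [one_div, Real.pow_rpow_inv_natCast hy hr, ← one_div] at h1

theorem one_le_rpow_mul {x y : ℝ} (hx : 0 ≤ x) (hy : 0 ≤ y) {r : ℕ} (hr : r ≠ 0)
    (h : 1 ≤ x * y ^ r) : 1 ≤ x ^ (1 / (r : ℝ)) * y := by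
  have h1 := Real.rpow_le_rpow zero_le_one h (by positivity : (0 : ℝ) ≤ 1 / (r : ℝ))
  rwa [Real.one_rpow, Real.mul_rpow hx (by positivity), one_div,
    Real.pow_rpow_inv_natCast hy hr, ← one_div] at h1

theorem one_div_choose_two (k : ℕ) :
    1 / ((k.choose 2 : ℕ) : ℝ) = 2 / ((k : ℝ) * ((k : ℝ) - 1)) := by
  rw [Nat.cast_choose_two, one_div_div]

theorem one_div_choose_succ_two (k : ℕ) :
    1 / (((k + 1).choose 2 : ℕ) : ℝ) = 2 / ((k : ℝ) * ((k : ℝ) + 1)) := by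
  rw [Nat.cast_choose_two, one_div_div]
  push_cast
  rw [add_sub_cancel_right, mul_comm]

/-- Absorbs the factor 2(k + 1) into the power (2D)^(k choose 2), which is why only a factor 2
stands before the power of δ below. -/
theorem two_mul_add_one_le {k : ℕ} (hk : 3 ≤ k) : 2 * (k + 1) ≤ 2 ^ (k.choose 2) := by
  induction k, hk using Nat.le_induction with
  | base => decide
  | succ k hk ih =>
    rw [Nat.choose_succ_succ' k 1, Nat.choose_one_right, pow_add]
    have : 2 ≤ 2 ^ k := by
      simpa using Nat.pow_le_pow_right (n := 2) (by norm_num) (by omega : 1 ≤ k)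
    nlinarith

/-- The arithmetic consequence of `one_le_of_eval_ne`. -/
theorem one_le_rpow_add_mul {k : ℕ} (hk : 3 ≤ k) {Λ δ D : ℝ} (hΛ : 0 ≤ Λ) (hδ : 0 ≤ δ)
    (hD : 0 ≤ D)
    (h : 1 ≤ (k + 1) * δ * D ^ (k.choose 2) + Λ / k.factorial * D ^ ((k + 1).choose 2)) :
    1 ≤ (Λ ^ (2 / ((k : ℝ) * ((k : ℝ) + 1))) + 2 * δ ^ (2 / ((k : ℝ) * ((k : ℝ) - 1)))) * D := by
  have hr2 : k.choose 2 ≠ 0 := (Nat.choose_pos (by omega)).ne'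
  have hr1 : (k + 1).choose 2 ≠ 0 := (Nat.choose_pos (by omega)).ne'
  rw [← one_div_choose_two, ← one_div_choose_succ_two, add_mul]
  -- One of the two summands is at least 1/2; its root alone gives the bound.
  rcases le_total (1 / 2) ((k + 1) * δ * D ^ (k.choose 2)) with h1 | h1
  · have h2 : 1 ≤ δ * (2 * D) ^ (k.choose 2) := by
      have h3 : (2 * ((k : ℝ) + 1)) ≤ 2 ^ (k.choose 2) := by exact_mod_cast two_mul_add_one_le hk
      calc (1 : ℝ) ≤ (2 * ((k : ℝ) + 1)) * (δ * D ^ (k.choose 2)) := by linarith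
        _ ≤ 2 ^ (k.choose 2) * (δ * D ^ (k.choose 2)) := by gcongr
        _ = _ := by rw [mul_pow]; ring
    have h4 := one_le_rpow_mul hδ (by positivity) hr2 h2
    have h5 : 0 ≤ Λ ^ (1 / (((k + 1).choose 2 : ℕ) : ℝ)) * D := by positivity
    linarith
  · have hfac : (2 : ℝ) ≤ k.factorial := by
      have := Nat.self_le_factorial k
      exact_mod_cast (by omega : 2 ≤ k.factorial)
    have h2 : 1 ≤ Λ * D ^ ((k + 1).choose 2) := by
      have h3 : 1 / 2 ≤ Λ / k.factorial * D ^ ((k + 1).choose 2) := by linarith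
      have h4 : Λ / k.factorial * D ^ ((k + 1).choose 2) ≤
          Λ / 2 * D ^ ((k + 1).choose 2) := by gcongr
      linarith
    have h4 := one_le_rpow_mul hΛ hD hr1 h2
    have h5 : 0 ≤ 2 * δ ^ (1 / ((k.choose 2 : ℕ) : ℝ)) * D := by positivity
    linarith

/-! ### Long arcs -/

/-- The denominator of the values of `P` at the integers. -/
theorem exists_value_denominator {k : ℕ} {G : Finset ℤ} (hG : k ≤ G.card) {P : ℝ[X]}
    (hP : P.degree < k) (hPG : ∀ n ∈ G, ∃ z : ℤ, P.eval (n : ℝ) = z) :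
    ∃ q : ℕ, 0 < q ∧ (∀ n : ℤ, ∃ z : ℤ, (q : ℝ) * P.eval (n : ℝ) = z) ∧
      ∀ F ⊆ G, F.card = k → (q : ℝ) ≤ pairProd F := by
  classical
  have hall : ∀ F ⊆ G, F.card = k →
      0 < (pairProd F).toNat ∧
        ∀ n : ℤ, ∃ z : ℤ, (((pairProd F).toNat : ℕ) : ℝ) * P.eval (n : ℝ) = z := by
    intro F hF hc
    have hpos := pairProd_pos F
    have hcast : (((pairProd F).toNat : ℕ) : ℝ) = pairProd F := by
      exact_mod_cast Int.toNat_of_nonneg hpos.le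
    refine ⟨by omega, fun n => ?_⟩
    rw [hcast]
    exact exists_pairProd_mul_eval (by rw [hc]; exact hP) (fun x hx => hPG x (hF hx)) n
  have hex : ∃ q : ℕ, 0 < q ∧ ∀ n : ℤ, ∃ z : ℤ, (q : ℝ) * P.eval (n : ℝ) = z := by
    obtain ⟨F, hF, hc⟩ := Finset.exists_subset_card_eq hG
    exact ⟨_, hall F hF hc⟩
  -- The least denominator is needed: one and the same q must lie below the product of differences
  -- of every k-subset.
  refine ⟨Nat.find hex, (Nat.find_spec hex).1, (Nat.find_spec hex).2, fun F hF hc => ?_⟩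
  have h1 := Nat.find_min' hex (hall F hF hc)
  have hpos := pairProd_pos F
  have h2 : ((Nat.find hex : ℕ) : ℤ) ≤ pairProd F := by omega
  exact_mod_cast h2

/-- A long arc `G` with equation `y = P(x)` contains the end points of an interval of length `L`
on which `f` is close to `P`, and `L` controls the number of elements of `G`. -/
theorem exists_interval_of_arc {a b : ℝ} (hab : a < b) {k : ℕ} (hk : 3 ≤ k) {f : ℝ → ℝ}
    (hf : ContDiffOn ℝ k f (Icc a b))
    (hf0 : ∀ x ∈ Icc a b, iteratedDerivWithin k f (Icc a b) x ≠ 0) {P : ℝ[X]}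
    (hP : P.degree < k) {δ : ℝ} {G : Finset ℤ} {m : ℤ → ℤ}
    (hG : ∀ n ∈ G, (n : ℝ) ∈ Icc a b ∧ |f n - m n| < δ ∧ P.eval (n : ℝ) = m n)
    (hcard : 2 * k ^ 2 ≤ G.card) :
    ∃ u ∈ G, ∃ L : ℝ, 0 < L ∧ (∃ w ∈ G, (u : ℝ) + L = w) ∧
      (∀ x ∈ Icc (u : ℝ) (u + L), |f x - P.eval x| < δ) ∧
      (G.card : ℝ) ≤ 2 * k * L ∧
      ∃ q : ℕ, 0 < q ∧ (∀ n : ℤ, ∃ z : ℤ, (q : ℝ) * P.eval (n : ℝ) = z) ∧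
        (G.card : ℝ) ≤ 2 * (k : ℝ) ^ 2 * (L / (q : ℝ) ^ (2 / ((k : ℝ) * ((k : ℝ) - 1)))) := by
  obtain ⟨B, hBG, hBc, hB⟩ := exists_subset_small_on_hull hab (by omega) hf hf0 hP G
    (fun n hn => ⟨(hG n hn).1, by rw [(hG n hn).2.2]; exact (hG n hn).2.1⟩)
  -- The source of the threshold 2k²: it leaves 2k points in B, enough to absorb the additive terms
  -- in both counts below.
  have hB2 : 2 * k ≤ B.card := by nlinarith
  have hne : B.Nonempty := Finset.card_pos.1 (by omega)
  have hk0 : (3 : ℝ) ≤ k := by exact_mod_cast hk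
  have hBcR : (G.card : ℝ) ≤ k * B.card := by exact_mod_cast hBc
  have hB2R : (2 * k : ℝ) ≤ B.card := by exact_mod_cast hB2
  set u := B.min' hne with hu
  set w := B.max' hne with hw
  have hBI : ∀ n ∈ B, u ≤ n ∧ n ≤ w := fun n hn => ⟨B.min'_le n hn, B.le_max' n hn⟩
  have hcardI : (B.card : ℝ) ≤ (w - u : ℝ) + 1 := by
    have h1 : B.card ≤ (Finset.Icc u w).card :=
      Finset.card_le_card fun n hn => Finset.mem_Icc.2 (hBI n hn)
    have huw : u ≤ w := (hBI _ hne.choose_spec).1.trans (hBI _ hne.choose_spec).2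
    rw [Int.card_Icc] at h1
    have h2 : (B.card : ℤ) ≤ w - u + 1 := by omega
    exact_mod_cast h2
  have hL1 : (1 : ℝ) ≤ w - u := by linarith
  refine ⟨u, hBG (B.min'_mem hne), w - u, by linarith, ⟨w, hBG (B.max'_mem hne), by ring⟩,
    ?_, ?_, ?_⟩
  · intro x hx
    exact hB u (B.min'_mem hne) w (B.max'_mem hne) x (by simpa using hx)
  · nlinarith
  obtain ⟨q, hq, hqz, hqF⟩ := exists_value_denominator (by nlinarith : k ≤ G.card) hP
    (fun n hn => ⟨m n, (hG n hn).2.2⟩)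
  refine ⟨q, hq, hqz, ?_⟩
  have hr : k.choose 2 ≠ 0 := (Nat.choose_pos (by omega)).ne'
  rw [← one_div_choose_two]
  set σ : ℝ := (q : ℝ) ^ (1 / ((k.choose 2 : ℕ) : ℝ)) with hσ
  have hqR : (0 : ℝ) < q := by exact_mod_cast hq
  have hσ0 : 0 < σ := Real.rpow_pos_of_pos hqR _
  -- k points of diameter d satisfy q ≤ `pairProd F` ≤ d^(k choose 2), hence d ≥ σ.
  have hspread : ∀ F ⊆ B, F.card = k → ∃ x ∈ F, ∃ y ∈ F, σ ≤ (y : ℝ) - x := by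
    intro F hF hc
    have hFne : F.Nonempty := Finset.card_pos.1 (by omega)
    refine ⟨_, F.min'_mem hFne, _, F.max'_mem hFne, ?_⟩
    have hxy : ((F.min' hFne : ℤ) : ℝ) ≤ F.max' hFne := by
      exact_mod_cast F.min'_le _ (F.max'_mem hFne)
    refine rpow_le_of_le_pow hqR.le (by linarith) hr ((hqF F (hF.trans hBG) hc).trans ?_)
    rw [← hc]
    refine pairProd_le (by linarith) fun x hx y hy => ?_
    have h1 : ((F.min' hFne : ℤ) : ℝ) ≤ x := by exact_mod_cast F.min'_le x hx
    have h2 : ((F.min' hFne : ℤ) : ℝ) ≤ y := by exact_mod_cast F.min'_le y hy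
    have h3 : (x : ℝ) ≤ F.max' hFne := by exact_mod_cast F.le_max' x hx
    have h4 : (y : ℝ) ≤ F.max' hFne := by exact_mod_cast F.le_max' y hy
    exact abs_sub_le_iff.2 ⟨by linarith, by linarith⟩
  have hcount := card_le_of_spread (u := (u : ℝ)) (L := w - u) (by omega : 1 ≤ k) hσ0
    (fun n hn => ⟨by exact_mod_cast (hBI n hn).1,
      by rw [add_sub_cancel]; exact_mod_cast (hBI n hn).2⟩) (by linarith) hspread
  have hLσ : 0 ≤ ((w : ℝ) - u) / σ := by positivity
  -- From |B| ≤ (k-1)(L/σ + 1) and k - 1 ≤ |B|/2.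
  have hBle : (B.card : ℝ) ≤ 2 * k * (((w : ℝ) - u) / σ) := by nlinarith
  nlinarith

/-- Counting the points of a long arc that is followed by a point outside of its curve. -/
theorem card_arc_le {a b : ℝ} (hab : a < b) {k : ℕ} (hk : 3 ≤ k) {f : ℝ → ℝ}
    (hf : ContDiffOn ℝ k f (Icc a b)) {lam c : ℝ} (hc : 1 ≤ c) (hlam0 : 0 < lam)
    (hlam : ∀ x ∈ Icc a b, lam ≤ |iteratedDerivWithin k f (Icc a b) x| ∧
      |iteratedDerivWithin k f (Icc a b) x| ≤ c * lam) {P : ℝ[X]}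
    (hP : P.degree < k) {δ : ℝ} {G : Finset ℤ} {m : ℤ → ℤ}
    (hG : ∀ n ∈ G, (n : ℝ) ∈ Icc a b ∧ |f n - m n| < δ ∧ P.eval (n : ℝ) = m n)
    (hcard : 2 * k ^ 2 ≤ G.card) {s v : ℤ} (hs : (s : ℝ) ∈ Icc a b) (hsm : |f s - m s| < δ)
    (hPs : P.eval (s : ℝ) ≠ m s) (hGs : ∀ n ∈ G, v ≤ n ∧ n < s) :
    (G.card : ℝ) ≤ 2 * (k : ℝ) ^ 2 *
      (3 * c * (2 * (k : ℝ) ^ 2) ^ k * δ) ^ (2 / ((k : ℝ) * ((k : ℝ) - 1))) * (s - v) := by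
  have hk0 : (3 : ℝ) ≤ k := by exact_mod_cast hk
  have hδ : 0 < δ := (abs_nonneg _).trans_lt hsm
  obtain ⟨u, hu, L, hL, ⟨w, hw, huw⟩, hgL, -, q, hq, hqz, hGq⟩ := exists_interval_of_arc hab hk hf
    (fun x hx h0 => by have := (hlam x hx).1; rw [h0, abs_zero] at this; linarith) hP hG hcard
  have hqR : (0 : ℝ) < q := by exact_mod_cast hq
  have hws : (w : ℝ) ≤ s := by exact_mod_cast (hGs w hw).2.le
  have hvu : (v : ℝ) ≤ u := by exact_mod_cast (hGs u hu).1
  have hext := abs_sub_eval_le_of_small hab (by omega) hf hc hlam hP hL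
    (Icc_subset_Icc (hG u hu).1.1 (by rw [huw]; exact (hG w hw).1.2))
    (fun x hx => (hgL x hx).le) hs (by rw [huw]; exact hws)
  set D : ℝ := (s : ℝ) - u with hD
  have hLD : L ≤ D := by rw [hD]; linarith
  have hD0 : 0 < D := hL.trans_le hLD
  obtain ⟨z, hz⟩ := hqz s
  have hone : 1 ≤ (q : ℝ) * |P.eval (s : ℝ) - m s| := by
    have h1 : (q : ℝ) * |P.eval (s : ℝ) - m s| = |(z : ℝ) - q * m s| := by
      rw [← hz, ← mul_sub, abs_mul, Nat.abs_cast]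
    have hne : z - q * m s ≠ 0 := by
      intro h
      apply hPs
      have : (z : ℝ) = q * m s := by exact_mod_cast sub_eq_zero.1 h
      exact mul_left_cancel₀ hqR.ne' (hz.trans this)
    rw [h1]
    exact_mod_cast Int.one_le_abs hne
  set A : ℝ := c * (2 * (k : ℝ) ^ 2) ^ k with hA
  have hA1 : 1 ≤ A := by
    have : (1 : ℝ) ≤ (2 * (k : ℝ) ^ 2) ^ k := one_le_pow₀ (by nlinarith)
    exact one_le_mul_of_one_le_of_one_le hc this
  have hDL : 1 ≤ (D / L) ^ k := one_le_pow₀ (by rwa [le_div_iff₀ hL, one_mul])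
  have htri : |P.eval (s : ℝ) - m s| ≤ 3 * A * δ * (D / L) ^ k := by
    have h1 : P.eval (s : ℝ) - m s = (f s - m s) - (f s - P.eval (s : ℝ)) := by ring
    have h2 : δ ≤ A * δ * (D / L) ^ k := by
      calc δ = 1 * δ * 1 := by ring
        _ ≤ _ := by gcongr
    rw [h1]
    refine (abs_sub _ _).trans ((add_le_add hsm.le hext).trans ?_)
    have h3 : 2 * c * (2 * (k : ℝ) ^ 2) ^ k * δ * (D / L) ^ k = 2 * (A * δ * (D / L) ^ k) := by
      rw [hA]; ring
    rw [h3]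
    linarith
  have hx : (L / D) ^ k ≤ q * (3 * A * δ) := by
    have h1 : 1 ≤ q * (3 * A * δ) * (D / L) ^ k := by
      rw [mul_assoc]
      exact hone.trans (by gcongr)
    have h2 : (D / L) ^ k = ((L / D) ^ k)⁻¹ := by rw [← inv_pow, inv_div]
    rwa [h2, ← div_eq_mul_inv, le_div_iff₀ (by positivity), one_mul] at h1
  set e : ℝ := 2 / ((k : ℝ) * ((k : ℝ) - 1)) with he
  have he0 : 0 ≤ e := div_nonneg zero_le_two (mul_nonneg (by linarith) (by linarith))
  -- Here k ≥ 3 is essential: L/D ≤ 1 then lets L/D be replaced by its power ke, so that q appears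
  -- to exactly the power e that divides L in `hGq`.
  have hke : (k : ℝ) * e ≤ 1 := by
    have h1 : (0 : ℝ) < k - 1 := by linarith
    have h2 : (k : ℝ) * e = 2 / ((k : ℝ) - 1) := by rw [he]; field_simp
    rw [h2, div_le_one h1]
    linarith
  have hratio : L / D ≤ (q : ℝ) ^ e * (3 * A * δ) ^ e := by
    have hpos : 0 < L / D := by positivity
    have hle : L / D ≤ 1 := by rwa [div_le_one hD0]
    calc L / D = (L / D) ^ (1 : ℝ) := (Real.rpow_one _).symm
      _ ≤ (L / D) ^ ((k : ℝ) * e) := Real.rpow_le_rpow_of_exponent_ge hpos hle hke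
      _ = ((L / D) ^ k) ^ e := by rw [Real.rpow_mul hpos.le, Real.rpow_natCast]
      _ ≤ (q * (3 * A * δ)) ^ e := Real.rpow_le_rpow (by positivity) hx he0
      _ = _ := Real.mul_rpow hqR.le (by positivity)
  have hqe : 0 < (q : ℝ) ^ e := Real.rpow_pos_of_pos hqR _
  have hfin : L / (q : ℝ) ^ e ≤ (3 * A * δ) ^ e * D := by
    rw [div_le_iff₀ hD0] at hratio
    rw [div_le_iff₀ hqe]
    linarith
  have h3A : 3 * c * (2 * (k : ℝ) ^ 2) ^ k * δ = 3 * A * δ := by rw [hA]; ring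
  rw [h3A]
  calc (G.card : ℝ) ≤ 2 * (k : ℝ) ^ 2 * (L / (q : ℝ) ^ e) := hGq
    _ ≤ 2 * (k : ℝ) ^ 2 * ((3 * A * δ) ^ e * D) := by gcongr
    _ ≤ 2 * (k : ℝ) ^ 2 * ((3 * A * δ) ^ e * (s - v)) := by gcongr; rw [hD]; linarith
    _ = _ := by ring

/-- Counting the points of an arbitrary long arc. -/
theorem card_last_arc_le {a b : ℝ} (hab : a < b) {k : ℕ} (hk : 3 ≤ k) {f : ℝ → ℝ}
    (hf : ContDiffOn ℝ k f (Icc a b)) {lam : ℝ} (hlam0 : 0 < lam)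
    (hlam : ∀ x ∈ Icc a b, lam ≤ |iteratedDerivWithin k f (Icc a b) x|) {P : ℝ[X]}
    (hP : P.degree < k) {δ : ℝ} {G : Finset ℤ} {m : ℤ → ℤ}
    (hG : ∀ n ∈ G, (n : ℝ) ∈ Icc a b ∧ |f n - m n| < δ ∧ P.eval (n : ℝ) = m n)
    (hcard : 2 * k ^ 2 ≤ G.card) :
    (G.card : ℝ) ≤ 4 * (k : ℝ) ^ 3 * (δ / lam) ^ (1 / (k : ℝ)) := by
  obtain ⟨u, hu, L, hL, ⟨w, hw, huw⟩, hgL, hGL, -⟩ := exists_interval_of_arc hab hk hf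
    (fun x hx h0 => by have := hlam x hx; rw [h0, abs_zero] at this; linarith) hP hG hcard
  have hδ : 0 < δ := (abs_nonneg _).trans_lt (hG u hu).2.1
  have h1 := mul_pow_le_of_small hab (by omega) hf hlam hP hL
    (Icc_subset_Icc (hG u hu).1.1 (by rw [huw]; exact (hG w hw).1.2))
    (fun x hx => (hgL x hx).le)
  have hk0 : (0 : ℝ) < k := by exact_mod_cast (by omega : 0 < k)
  have h2 : (L / (2 * (k : ℝ) ^ 2)) ^ k ≤ δ / lam := by
    rw [div_pow, div_le_div_iff₀ (by positivity) hlam0]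
    linarith
  have h3 := le_rpow_of_pow_le (by positivity) (by omega) h2
  rw [div_le_iff₀ (by positivity)] at h3
  calc (G.card : ℝ) ≤ 2 * k * L := hGL
    _ ≤ 2 * k * ((δ / lam) ^ (1 / (k : ℝ)) * (2 * (k : ℝ) ^ 2)) := by gcongr
    _ = _ := by ring

/-! ### Greedy cutting and the count -/

/-- Cutting a finite set of integers into initial segments. -/
theorem card_le_of_initial_segments {S : Finset ℤ} {K E : ℝ} (hK : 0 ≤ K)
    (hstep : ∀ T ⊆ S, (T.card : ℝ) ≤ E ∨ ∃ w ∈ T, ∃ s ∈ T, w < s ∧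
      ((T.filter (· < s)).card : ℝ) ≤ K * (s - w))
    {u v : ℤ} (huv : u ≤ v) (hS : ∀ n ∈ S, u ≤ n ∧ n ≤ v) :
    (S.card : ℝ) ≤ K * (v - u) + E := by
  suffices H : ∀ T : Finset ℤ, T ⊆ S → ∀ u : ℤ, u ≤ v → (∀ n ∈ T, u ≤ n) →
      (T.card : ℝ) ≤ K * (v - u) + E from
    H S (Finset.Subset.refl S) u huv fun n hn => (hS n hn).1
  -- The left end u varies in the induction: a cut costs at most K(s - u), the rest starts at s, and
  -- E is paid only once.
  intro T
  induction T using Finset.strongInduction with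
  | H T ih =>
    intro hT u huv hu
    rcases hstep T hT with h | ⟨w, hw, s, hs, hws, hle⟩
    · have : (u : ℝ) ≤ v := by exact_mod_cast huv
      nlinarith
    · have hss : T.filter (fun n => ¬ n < s) ⊂ T :=
        Finset.filter_ssubset.2 ⟨w, hw, by simpa using hws⟩
      have h1 := ih _ hss (hss.1.trans hT) s (hS s (hT hs)).2
        (fun n hn => not_lt.1 (Finset.mem_filter.1 hn).2)
      have h2 : (T.card : ℝ) = (T.filter (· < s)).card + (T.filter (fun n => ¬ n < s)).card := by
        exact_mod_cast (Finset.card_filter_add_card_filter_not (s := T) (· < s)).symm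
      have h3 : (u : ℝ) ≤ w := by exact_mod_cast hu w hw
      nlinarith

theorem exists_initial_subset (T : Finset ℤ) {j : ℕ} (hj : j ≤ T.card) :
    ∃ F ⊆ T, F.card = j ∧ ∀ x ∈ F, ∀ y ∈ T, y ∉ F → x < y := by
  induction j with
  | zero => exact ⟨∅, by simp, rfl, by simp⟩
  | succ j ih =>
    obtain ⟨F, hF, hc, hlt⟩ := ih (by omega)
    have hne : (T \ F).Nonempty := by
      rw [← Finset.card_pos, Finset.card_sdiff_of_subset hF]
      omega
    have hmem := Finset.mem_sdiff.1 ((T \ F).min'_mem hne)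
    refine ⟨insert ((T \ F).min' hne) F, Finset.insert_subset hmem.1 hF,
      by rw [Finset.card_insert_of_notMem hmem.2, hc], ?_⟩
    intro x hx y hy hyF
    rw [Finset.mem_insert, not_or] at hyF
    rcases Finset.mem_insert.1 hx with rfl | hx
    · exact lt_of_le_of_ne ((T \ F).min'_le y (Finset.mem_sdiff.2 ⟨hy, hyF.2⟩)) (Ne.symm hyF.1)
    · exact hlt x hx y hy hyF.2

/-- The number of integers near which `f` is close to an integer, with all constants explicit. -/
theorem closeCount_le {k : ℕ} (hk : 3 ≤ k) {c : ℝ} (hc : 1 ≤ c) {f : ℝ → ℝ} {N : ℕ} {lam δ : ℝ}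
    (h : Setting k c f N lam δ) :
    (closeCount f N δ : ℝ) ≤
      2 * (k : ℝ) ^ 2 * ((c * lam) ^ (2 / ((k : ℝ) * ((k : ℝ) + 1))) +
        2 * δ ^ (2 / ((k : ℝ) * ((k : ℝ) - 1))) +
        (3 * c * (2 * (k : ℝ) ^ 2) ^ k * δ) ^ (2 / ((k : ℝ) * ((k : ℝ) - 1)))) * N +
      (2 * (k : ℝ) ^ 2 + 4 * (k : ℝ) ^ 3 * (δ / lam) ^ (1 / (k : ℝ))) := by
  classical
  have hlam0 := h.lam_pos
  have hδ := h.delta_pos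
  have hN : (1 : ℝ) ≤ N := by exact_mod_cast h.one_le_N
  have hab : (N : ℝ) < 2 * N := by linarith
  have hf : ContDiffOn ℝ k f (Icc (N : ℝ) (2 * N)) := h.contDiffOn
  have hΛ0 : 0 ≤ c * lam := by positivity
  set m : ℤ → ℤ := fun n => round (f n) with hm
  have hS : ∀ n ∈ closePoints f N δ, ((N : ℤ) ≤ n ∧ n ≤ 2 * N) ∧ |f n - m n| < δ := by
    intro n hn
    obtain ⟨h1, h2⟩ := Finset.mem_filter.1 hn
    exact ⟨Finset.mem_Icc.1 h1, h2⟩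
  have hSR : ∀ n ∈ closePoints f N δ, (n : ℝ) ∈ Icc (N : ℝ) (2 * N) := fun n hn =>
    ⟨by exact_mod_cast (hS n hn).1.1, by exact_mod_cast (hS n hn).1.2⟩
  set X : ℝ := (c * lam) ^ (2 / ((k : ℝ) * ((k : ℝ) + 1))) +
    2 * δ ^ (2 / ((k : ℝ) * ((k : ℝ) - 1))) with hX
  set Y : ℝ := (3 * c * (2 * (k : ℝ) ^ 2) ^ k * δ) ^ (2 / ((k : ℝ) * ((k : ℝ) - 1))) with hY
  have hX0 : 0 ≤ X := by positivity
  have hY0 : 0 ≤ Y := by positivity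
  have hR0 : 0 ≤ (δ / lam) ^ (1 / (k : ℝ)) := by positivity
  have hmain := card_le_of_initial_segments (S := closePoints f N δ)
    (K := 2 * (k : ℝ) ^ 2 * (X + Y))
    (E := 2 * (k : ℝ) ^ 2 + 4 * (k : ℝ) ^ 3 * (δ / lam) ^ (1 / (k : ℝ)))
    (u := N) (v := 2 * N) (by positivity) ?_ (by omega) (fun n hn => (hS n hn).1)
  · push_cast at hmain
    rwa [show (2 * (N : ℝ) - N) = N by ring] at hmain
  intro T hT
  rcases lt_or_ge T.card (2 * k ^ 2) with hlt | hge
  · left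
    have : (T.card : ℝ) ≤ 2 * (k : ℝ) ^ 2 := by exact_mod_cast hlt.le
    have : 0 ≤ 4 * (k : ℝ) ^ 3 * (δ / lam) ^ (1 / (k : ℝ)) := by positivity
    linarith
  obtain ⟨F, hFT, hFc, hFlt⟩ := exists_initial_subset T (by nlinarith : k ≤ T.card)
  -- The first k points determine P, so any failure P(s) ≠ m(s) occurs to the right of all of F.
  set P : ℝ[X] := Lagrange.interpolate F (fun n : ℤ => (n : ℝ)) (fun n => (m n : ℝ)) with hPdef
  have hP : P.degree < k := by
    rw [← hFc]
    exact Lagrange.degree_interpolate_lt _ (intCast_injOn F)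
  have hPF : ∀ n ∈ F, P.eval (n : ℝ) = m n := fun n hn =>
    Lagrange.eval_interpolate_at_node (fun n => (m n : ℝ)) (intCast_injOn F) hn
  rcases (T.filter fun n : ℤ => P.eval (n : ℝ) ≠ m n).eq_empty_or_nonempty with hemp | hne
  · left
    have hTP : ∀ n ∈ T, P.eval (n : ℝ) = m n := fun n hn => by
      by_contra hcon
      have : n ∈ T.filter fun n : ℤ => P.eval (n : ℝ) ≠ m n := Finset.mem_filter.2 ⟨hn, hcon⟩
      rw [hemp] at this
      simp at this
    have := card_last_arc_le hab hk hf hlam0 (fun x hx => (h.bounds x hx).1) hP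
      (fun n hn => ⟨hSR n (hT hn), (hS n (hT hn)).2, hTP n hn⟩) hge
    have : 0 ≤ 2 * (k : ℝ) ^ 2 := by positivity
    linarith
  right
  set s := (T.filter fun n : ℤ => P.eval (n : ℝ) ≠ m n).min' hne with hs
  obtain ⟨hsT, hsP⟩ := Finset.mem_filter.1 (Finset.min'_mem _ hne)
  rw [← hs] at hsT hsP
  have hsF : s ∉ F := fun hmem => hsP (hPF s hmem)
  have hFs : ∀ x ∈ F, x < s := fun x hx => hFlt x hx s hsT hsF
  have hTne : T.Nonempty := ⟨s, hsT⟩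
  set w := T.min' hTne with hw
  have hwT : w ∈ T := T.min'_mem hTne
  have hwle : ∀ n ∈ T, w ≤ n := fun n hn => T.min'_le n hn
  obtain ⟨x₀, hx₀⟩ : F.Nonempty := Finset.card_pos.1 (by omega)
  have hws : w < s := (hwle x₀ (hFT hx₀)).trans_lt (hFs x₀ hx₀)
  have hwsR : (0 : ℝ) < (s : ℝ) - w := sub_pos.2 (by exact_mod_cast hws)
  refine ⟨w, hwT, s, hsT, hws, ?_⟩
  rcases lt_or_ge (T.filter (· < s)).card (2 * k ^ 2) with hlt | hge'
  -- Few points before s: F and s all lie in [w, s] and are on no common curve, so X(s - w) ≥ 1,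
  -- which pays for the fewer than 2k² points.
  · have hone := one_le_of_eval_ne hab hf (fun x hx => (h.bounds x hx).2) hP hFc (m := m)
      hwsR.le hsF
      (fun n hn => by
        have hn' : n ∈ closePoints f N δ := hT (Finset.insert_subset hsT hFT hn)
        exact ⟨hSR n hn', (hS n hn').2.le⟩)
      (fun x hx y hy => by
        have hb : ∀ n ∈ insert s F, (w : ℝ) ≤ n ∧ (n : ℝ) ≤ s := fun n hn =>
          ⟨by exact_mod_cast hwle n (Finset.insert_subset hsT hFT hn), by
            rcases Finset.mem_insert.1 hn with rfl | hn
            · exact le_rfl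
            · exact_mod_cast (hFs n hn).le⟩
        have h1 := hb x hx
        have h2 := hb y hy
        exact abs_sub_le_iff.2 ⟨by linarith, by linarith⟩) hPF hsP
    have hXD : 1 ≤ X * (s - w) := one_le_rpow_add_mul hk hΛ0 hδ.le hwsR.le hone
    have h1 : ((T.filter (· < s)).card : ℝ) ≤ 2 * (k : ℝ) ^ 2 := by exact_mod_cast hlt.le
    calc ((T.filter (· < s)).card : ℝ) ≤ 2 * (k : ℝ) ^ 2 * 1 := by rwa [mul_one]
      _ ≤ 2 * (k : ℝ) ^ 2 * (X * (s - w)) := by gcongr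
      _ ≤ 2 * (k : ℝ) ^ 2 * ((X + Y) * (s - w)) := by gcongr; linarith
      _ = _ := by ring
  · have h1 := card_arc_le hab hk hf hc hlam0 h.bounds hP (m := m) (δ := δ) (s := s) (v := w)
      (fun n hn => by
        obtain ⟨hnT, hns⟩ := Finset.mem_filter.1 hn
        refine ⟨hSR n (hT hnT), (hS n (hT hnT)).2, ?_⟩
        by_contra hcon
        exact absurd (Finset.min'_le _ n (Finset.mem_filter.2 ⟨hnT, hcon⟩)) (not_le.2 hns))
      hge' (hSR s (hT hsT)) (hS s (hT hsT)).2 hsP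
      (fun n hn => ⟨hwle n (Finset.mem_filter.1 hn).1, (Finset.mem_filter.1 hn).2⟩)
    rw [← hY] at h1
    calc _ ≤ 2 * (k : ℝ) ^ 2 * Y * (s - w) := h1
      _ ≤ 2 * (k : ℝ) ^ 2 * (X + Y) * (s - w) := by gcongr; linarith

/-! ### Explicit constants and conclusion -/

theorem six_mul_sq_le {k : ℕ} (hk : 3 ≤ k) : 6 * k ^ 2 ≤ 14 ^ (k - 1) := by
  induction k, hk using Nat.le_induction with
  | base => norm_num
  | succ k hk ih =>
    obtain ⟨j, rfl⟩ : ∃ j, k = j + 1 := ⟨k - 1, by omega⟩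
    simp only [Nat.add_sub_cancel] at ih ⊢
    rw [pow_succ 14 j]
    nlinarith

/-- Since k(k-1) = 2·(k choose 2), the bound 6k² ≤ 14^(k-1) gives (6k²)^k ≤ 196^(k choose 2), and
196 = 14² is just below 10e³ ≈ 200.9. -/
theorem spacing_constant_le {k : ℕ} (hk : 3 ≤ k) :
    (3 * (2 * (k : ℝ) ^ 2) ^ k) ^ (2 / ((k : ℝ) * ((k : ℝ) - 1))) ≤ 10 * Real.exp 3 := by
  rw [← one_div_choose_two]
  refine rpow_le_of_le_pow (by positivity) (by positivity) (Nat.choose_pos (by omega)).ne' ?_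
  have h1 : (6 * (k : ℝ) ^ 2) ≤ 14 ^ (k - 1) := by exact_mod_cast six_mul_sq_le hk
  have hexp : (196 : ℝ) ≤ 10 * Real.exp 3 := by
    have h2 : Real.exp 3 = Real.exp 1 ^ 3 := by rw [← Real.exp_nat_mul]; norm_num
    have h3 : (2.7182 : ℝ) ≤ Real.exp 1 := by linarith [Real.exp_one_gt_d9]
    have h4 : (2.7182 : ℝ) ^ 3 ≤ Real.exp 1 ^ 3 := by gcongr
    rw [h2]
    norm_num at h4 ⊢
    linarith
  have h3 : (3 : ℝ) ≤ 3 ^ k := by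
    simpa using pow_le_pow_right₀ (by norm_num : (1 : ℝ) ≤ 3) (by omega : 1 ≤ k)
  have hch : (k - 1) * k = 2 * k.choose 2 := by
    rw [Nat.choose_two_right, Nat.mul_div_cancel' (Nat.even_mul_pred_self k).two_dvd, mul_comm]
  calc 3 * (2 * (k : ℝ) ^ 2) ^ k ≤ 3 ^ k * (2 * (k : ℝ) ^ 2) ^ k := by gcongr
    _ = (6 * (k : ℝ) ^ 2) ^ k := by rw [← mul_pow]; ring
    _ ≤ (14 ^ (k - 1)) ^ k := by gcongr
    _ = 196 ^ (k.choose 2) := by rw [← pow_mul, hch, pow_mul]; norm_num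
    _ ≤ _ := by gcongr

/-- The bound with the constants of the disjoint case. It needs no disjointness assumption: the
points are cut into successive arcs, and the next point of `S` after an arc lies off its curve, so
that it is far away from the first point of the arc. -/
theorem closeCount_le_explicit {k : ℕ} (hk : 3 ≤ k) {c : ℝ} (hc : 1 ≤ c) {f : ℝ → ℝ} {N : ℕ}
    {lam δ : ℝ} (h : Setting k c f N lam δ) :
    (closeCount f N δ : ℝ) ≤
      2 * (k : ℝ) ^ 2 * c ^ (2 / ((k : ℝ) * ((k : ℝ) + 1))) *
          (N : ℝ) * lam ^ (2 / ((k : ℝ) * ((k : ℝ) + 1))) +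
        4 * (k : ℝ) ^ 2 * (5 * Real.exp 3 * c ^ (2 / ((k : ℝ) * ((k : ℝ) - 1))) + 1) *
          (N : ℝ) * δ ^ (2 / ((k : ℝ) * ((k : ℝ) - 1))) +
        8 * (k : ℝ) ^ 3 * (δ / lam) ^ (1 / (k : ℝ)) +
        2 * (k : ℝ) ^ 2 * (5 * Real.exp 3 + 1) := by
  have hlam0 := h.lam_pos
  have hδ := h.delta_pos
  have hc0 : 0 ≤ c := by linarith
  have h1 := closeCount_le hk hc h
  have hC := spacing_constant_le hk
  rw [Real.mul_rpow hc0 hlam0.le,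
    show 3 * c * (2 * (k : ℝ) ^ 2) ^ k * δ = 3 * (2 * (k : ℝ) ^ 2) ^ k * c * δ by ring,
    Real.mul_rpow (by positivity) hδ.le, Real.mul_rpow (by positivity) hc0] at h1
  set a := lam ^ (2 / ((k : ℝ) * ((k : ℝ) + 1)))
  set ca := c ^ (2 / ((k : ℝ) * ((k : ℝ) + 1)))
  set d := δ ^ (2 / ((k : ℝ) * ((k : ℝ) - 1)))
  set cd := c ^ (2 / ((k : ℝ) * ((k : ℝ) - 1)))
  set M := (3 * (2 * (k : ℝ) ^ 2) ^ k) ^ (2 / ((k : ℝ) * ((k : ℝ) - 1)))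
  set R := (δ / lam) ^ (1 / (k : ℝ))
  have hd : 0 ≤ d := by positivity
  have hcd : 0 ≤ cd := by positivity
  have hR : 0 ≤ R := by positivity
  -- The δ-terms now match exactly: 2k²·10e³ = 4k²·5e³ and 2k²·2 = 4k². The remaining terms have
  -- room to spare.
  have h2 : 2 * (k : ℝ) ^ 2 * (ca * a + 2 * d + M * cd * d) * N ≤
      2 * (k : ℝ) ^ 2 * (ca * a + 2 * d + 10 * Real.exp 3 * cd * d) * N := by gcongr
  have h3 : 0 ≤ 4 * (k : ℝ) ^ 3 * R := by positivity
  have h4 : 0 ≤ (k : ℝ) ^ 2 * Real.exp 3 := by positivity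
  linarith

end HuxleySargos

theorem theorem1 (k : ℕ) (hk : 3 ≤ k) (c : ℝ) (hc : 1 ≤ c) :
    (∀ (f : ℝ → ℝ) (N : ℕ) (lam δ : ℝ), HuxleySargos.Setting k c f N lam δ →
      (HuxleySargos.HasDisjointCovers k c f N δ →
        (HuxleySargos.closeCount f N δ : ℝ) ≤
          2 * (k : ℝ) ^ 2 * c ^ (2 / ((k : ℝ) * ((k : ℝ) + 1))) *
              (N : ℝ) * lam ^ (2 / ((k : ℝ) * ((k : ℝ) + 1))) +
            4 * (k : ℝ) ^ 2 * (5 * Real.exp 3 * c ^ (2 / ((k : ℝ) * ((k : ℝ) - 1))) + 1) *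
              (N : ℝ) * δ ^ (2 / ((k : ℝ) * ((k : ℝ) - 1))) +
            8 * (k : ℝ) ^ 3 * (δ / lam) ^ (1 / (k : ℝ)) +
            2 * (k : ℝ) ^ 2 * (5 * Real.exp 3 + 1)) ∧
      (HuxleySargos.closeCount f N δ : ℝ) ≤
        2 * (k : ℝ) ^ 2 * c ^ (2 / ((k : ℝ) * ((k : ℝ) + 1))) *
            (N : ℝ) * lam ^ (2 / ((k : ℝ) * ((k : ℝ) + 1))) +
          (30 * Real.exp 3 * (k : ℝ) ^ 2 * c ^ (2 / ((k : ℝ) * ((k : ℝ) - 1))) +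
              4 * (k : ℝ) ^ 2) *
            (N : ℝ) * δ ^ (2 / ((k : ℝ) * ((k : ℝ) - 1))) +
          16 * (k : ℝ) ^ 3 * (δ / lam) ^ (1 / (k : ℝ)) +
          2 * (k : ℝ) ^ 2 * (5 * Real.exp 3 + 1)) ∧
    (∃ C : ℝ, 0 < C ∧
      ∀ (f : ℝ → ℝ) (N : ℕ) (lam δ : ℝ), HuxleySargos.Setting k c f N lam δ →
        (HuxleySargos.closeCount f N δ : ℝ) ≤
          C * ((N : ℝ) * lam ^ (2 / ((k : ℝ) * ((k : ℝ) + 1))) +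
            (N : ℝ) * δ ^ (2 / ((k : ℝ) * ((k : ℝ) - 1))) +
            (δ / lam) ^ (1 / (k : ℝ)) + 1)) := by
  have key : ∀ (f : ℝ → ℝ) (N : ℕ) (lam δ : ℝ), HuxleySargos.Setting k c f N lam δ →
      (HuxleySargos.closeCount f N δ : ℝ) ≤
        2 * (k : ℝ) ^ 2 * c ^ (2 / ((k : ℝ) * ((k : ℝ) + 1))) *
            (N : ℝ) * lam ^ (2 / ((k : ℝ) * ((k : ℝ) + 1))) +
          (30 * Real.exp 3 * (k : ℝ) ^ 2 * c ^ (2 / ((k : ℝ) * ((k : ℝ) - 1))) +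
              4 * (k : ℝ) ^ 2) *
            (N : ℝ) * δ ^ (2 / ((k : ℝ) * ((k : ℝ) - 1))) +
          16 * (k : ℝ) ^ 3 * (δ / lam) ^ (1 / (k : ℝ)) +
          2 * (k : ℝ) ^ 2 * (5 * Real.exp 3 + 1) := by
    intro f N lam δ h
    refine (HuxleySargos.closeCount_le_explicit hk hc h).trans ?_
    have hlam0 := h.lam_pos
    have hδ := h.delta_pos
    have hc0 : 0 ≤ c := by linarith
    have h1 : 4 * (k : ℝ) ^ 2 * (5 * Real.exp 3 * c ^ (2 / ((k : ℝ) * ((k : ℝ) - 1))) + 1) ≤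
        30 * Real.exp 3 * (k : ℝ) ^ 2 * c ^ (2 / ((k : ℝ) * ((k : ℝ) - 1))) +
          4 * (k : ℝ) ^ 2 := by
      have : 0 ≤ Real.exp 3 * (k : ℝ) ^ 2 * c ^ (2 / ((k : ℝ) * ((k : ℝ) - 1))) := by positivity
      linarith
    gcongr
    norm_num
  refine ⟨fun f N lam δ h => ⟨fun _ => HuxleySargos.closeCount_le_explicit hk hc h,
    key f N lam δ h⟩, ?_⟩
  have hc0 : 0 < c := by linarith
  have hk0 : (0 : ℝ) < k := by exact_mod_cast (by omega : 0 < k)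
  obtain ⟨A, hA⟩ : ∃ A, A = 2 * (k : ℝ) ^ 2 * c ^ (2 / ((k : ℝ) * ((k : ℝ) + 1))) := ⟨_, rfl⟩
  obtain ⟨B, hB⟩ : ∃ B, B = 30 * Real.exp 3 * (k : ℝ) ^ 2 * c ^ (2 / ((k : ℝ) * ((k : ℝ) - 1))) +
      4 * (k : ℝ) ^ 2 := ⟨_, rfl⟩
  obtain ⟨D, hD⟩ : ∃ D, D = 16 * (k : ℝ) ^ 3 := ⟨_, rfl⟩
  obtain ⟨E, hE⟩ : ∃ E, E = 2 * (k : ℝ) ^ 2 * (5 * Real.exp 3 + 1) := ⟨_, rfl⟩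
  have hA0 : 0 < A := by rw [hA]; positivity
  have hB0 : 0 < B := by rw [hB]; positivity
  have hD0 : 0 < D := by rw [hD]; positivity
  have hE0 : 0 < E := by rw [hE]; positivity
  -- The sum of the four positive coefficients dominates each of them.
  refine ⟨A + B + D + E, by positivity, fun f N lam δ h => ?_⟩
  have hlam0 := h.lam_pos
  have hδ := h.delta_pos
  refine (key f N lam δ h).trans ?_
  rw [← hA, ← hB, ← hD, ← hE, mul_assoc A, mul_assoc B]
  have hx : 0 ≤ (N : ℝ) * lam ^ (2 / ((k : ℝ) * ((k : ℝ) + 1))) := by positivity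
  have hy : 0 ≤ (N : ℝ) * δ ^ (2 / ((k : ℝ) * ((k : ℝ) - 1))) := by positivity
  have hz : 0 ≤ (δ / lam) ^ (1 / (k : ℝ)) := by positivity
  generalize (N : ℝ) * lam ^ (2 / ((k : ℝ) * ((k : ℝ) + 1))) = x at hx ⊢
  generalize (N : ℝ) * δ ^ (2 / ((k : ℝ) * ((k : ℝ) - 1))) = y at hy ⊢
  generalize (δ / lam) ^ (1 / (k : ℝ)) = z at hz ⊢
  have h1 : A * x ≤ (A + B + D + E) * x := by gcongr; linarith
  have h2 : B * y ≤ (A + B + D + E) * y := by gcongr; linarith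
  have h3 : D * z ≤ (A + B + D + E) * z := by gcongr; linarith
  linarith
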